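/- Let $\mathcal Y=\{1,\dots,22\}$ be the set of players on the field, divided into two disjoint teams of $11$ players, and let $\mathcal I_i$ denote the team of player $i$. Let $\lambda_i\in(0,\infty)$ be rates, let $\mathbb P(S_i=1)=1-\mathbb P(S_i=0)\in[0,1]$ be success probabilities, and let $\mathbb P(i\to\cdot\mid S_i=0)$ and $\mathbb P(i\to\cdot\mid S_i=1)$ be probability distributions on $\mathcal Y$ that are concentrated on the opposing team $\mathcal Y\setminus\mathcal I_i$ and on the teammates $\mathcal I_i\setminus\{i\}$, respectively. (This includes $\lambda_i=\exp(\omega^\top c_i)$, logit success probabilities $\operatorname{logit}\mathbb P(S_i=1)=\alpha^\top x_{1,i}+\eta_{1,i}$, and multinomial logit pass probabilities with weights $\exp(\beta^\top x_{2,i,j}+\eta_{2,j})$ on $j\notin\mathcal I_i$ for $S_i=0$ and $\exp(\gamma^\top x_{3,i,j}+\eta_{3,j})$ on $j\in\mathcal I_i\setminus\{i\}$ for $S_i=1$, conditionally on the parameters and the random effects $\eta$.) Suppose that during a time interval $[t_1,t_2)$, $t_1<t_2$, the teams, rates and probabilities are these constant ones. The ball-control process $Y(t)$, $t\in[t_1,t_2)$,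 is constructed as follows. At time $t_1$ a random player is in control of the ball, in a possession that began a random time $a\ge 0$ before $t_1$; both belong to an arbitrary $\sigma$-algebra $\mathcal G$ of past events and have arbitrary laws. Given the past and that player $i$ is in control, the holding time of a possession of player $i$ that begins in $[t_1,t_2)$ is $\mathrm{Exponential}(\lambda_i)$; the holding time of the possession in progress at $t_1$ is $\mathrm{Exponential}(\lambda_i)$ conditioned to exceed $a$. When a holding time of player $i$ ends at a time before $t_2$, then, given the past and the holding time, the pass of player $i$ is a failure ($S_i=0$) or a success ($S_i=1$) with probabilities $\mathbb P(S_i=s)$, and given $S_i=s$ in addition, player $j$ receives the ball with probability $\mathbb P(i\to j\mid S_i=s)$. The state $Y(t)$ is the player in control of the ball at time $t$. For $t\in[t_1,t_2)$, let $\mathcal F_t$ be the $\sigma$-algebra generated by $\mathcal G$ and $Y(s)$, $t_1\le s\le t$. Let $$ q_{i,j}=\begin{cases} \lambda_i\,\mathbb P(S_i=0)\,\mathbb P(i\to j\mid S_i=0) & \text{if } i\ne j,\ j\notin\mathcal I_i,\\ \lambda_i\,\mathbb P(S_i=1)\,\mathbb P(i\to j\mid S_i=1) & \text{if } i\ne j,\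 j\in\mathcal I_i,\\ -\lambda_i & \text{if } i=j . \end{cases} $$ Then: (1) $\{Y(t),\,t\in[t_1,t_2)\}$ is a time-homogeneous Markov process with finite state space $\mathcal Y$, with almost surely right-continuous paths and with generator matrix $Q=(q_{i,j})$. That is, $q_{i,j}\ge0$ for $i\neq j$, $\sum_j q_{i,j}=0$, and $\mathbb P(Y(t+h)=j\mid\mathcal F_t)=(e^{hQ})_{Y(t),j}$ almost surely for all $j\in\mathcal Y$, $t\in[t_1,t_2)$ and $h\ge 0$ with $t+h<t_2$. (2) For all $t\in[t_1,t_2)$, $h\in(0,t_2-t)$ and $(i,j)\in\mathcal Y^2$: conditional on $\{Y(t)=i\}$, the event $\{Y(t+h)=j\}$ is independent of $\mathcal F_t$, in particular of $\{Y(s),\ t_1\le s\le t\}$. (3) For all $(i,j)\in\mathcal Y^2$, as $h\downarrow0$, $$\mathbb P(Y(t+h)=j\mid Y(t)=i)=\delta_{i,j}+q_{i,j}\,h+o(h),$$ for all $t\in[t_1,t_2)$ with $\mathbb P(Y(t)=i)>0$ and $h\in(0,t_2-t)$, where the $o(h)$ term does not depend on $t$. -/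

import Mathlib

open MeasureTheory ProbabilityTheory Set Filter Topology Asymptotics

/-- The data that are constant during the time interval: the 22 players `0, …, 21` form two teams
of 11 players; `rate i` is the rate of player `i`'s holding times, `success i` is the probability
`P(S_i = 1)` that a pass of player `i` stays within `i`'s team (so `P(S_i = 0) = 1 - success i`),
and `pass i s j` is the conditional probability `P(i → j | S_i = s)`, where `s = true` stands for
`S_i = 1` and `s = false` for `S_i = 0`. -/
structure BallModel where
  team : Fin 22 → Fin 2
  card_team : ∀ k, (Finset.univ.filter fun i => team i = k).card = 11
  rate : Fin 22 → ℝ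
  rate_pos : ∀ i, 0 < rate i
  success : Fin 22 → ℝ
  success_nonneg : ∀ i, 0 ≤ success i
  success_le_one : ∀ i, success i ≤ 1
  pass : Fin 22 → Bool → Fin 22 → ℝ
  pass_nonneg : ∀ i s j, 0 ≤ pass i s j
  pass_sum : ∀ i s, ∑ j, pass i s j = 1
  pass_failure_eq_zero : ∀ i j, team j = team i → pass i false j = 0
  pass_success_eq_zero : ∀ i j, (j = i ∨ team j ≠ team i) → pass i true j = 0

namespace BallModel

/-- `P(S_i = s)`. -/
def successProb (M : BallModel) (i : Fin 22) : Bool → ℝ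
  | true => M.success i
  | false => 1 - M.success i

/-- The matrix `Q` of the ball-control process. -/
def generator (M : BallModel) : Matrix (Fin 22) (Fin 22) ℝ :=
  Matrix.of fun i j =>
    if i = j then -M.rate i
    else if M.team j = M.team i then M.rate i * M.successProb i true * M.pass i true j
    else M.rate i * M.successProb i false * M.pass i false j

/-- The players who can receive the ball from `i`: players of the opposing team if the pass
fails, the other players of `i`'s team if it succeeds. -/
def receivers (team : Fin 22 → Fin 2) (i : Fin 22) : Bool → Finset (Fin 22)
  | true => Finset.univ.filter fun j => j ≠ i ∧ team j = team i
  | false => Finset.univ.filter fun j => team j ≠ team i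

theorem receivers_nonempty (team : Fin 22 → Fin 2)
    (card_team : ∀ k, (Finset.univ.filter fun i => team i = k).card = 11)
    (i : Fin 22) (s : Bool) : (receivers team i s).Nonempty := by
  cases s with
  | true =>
    obtain ⟨j, hj, hji⟩ := Finset.exists_mem_ne
      (s := Finset.univ.filter fun j => team j = team i) (by rw [card_team]; norm_num) i
    exact ⟨j, by simpa [receivers, hji] using hj⟩
  | false =>
    obtain ⟨j, hj⟩ : (Finset.univ.filter fun j => team j = team i + 1).Nonempty := by
      rw [← Finset.card_pos, card_team]; norm_num
    refine ⟨j, ?_⟩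
    simp only [receivers, Finset.mem_filter, Finset.mem_univ, true_and] at hj ⊢
    rw [hj]
    generalize team i = k
    revert k
    decide

/-- The log-linear / logit specification, given the parameters `ω, α, β, γ`, the attributes
`c_i, x_{1,i}, x_{2,i,j}, x_{3,i,j}` and the (realized) random effects
`η_i = (η_{1,i}, η_{2,i}, η_{3,i})`: rates `exp(ωᵀ c_i)`, success probabilities with logit
`αᵀ x_{1,i} + η_{1,i}`, and multinomial logit pass probabilities. -/
noncomputable def logit (team : Fin 22 → Fin 2)
    (card_team : ∀ k, (Finset.univ.filter fun i => team i = k).card = 11)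
    {p d₁ d₂ d₃ : ℕ} (ω : Fin p → ℝ) (α : Fin d₁ → ℝ) (β : Fin d₂ → ℝ) (γ : Fin d₃ → ℝ)
    (c : Fin 22 → Fin p → ℝ) (x₁ : Fin 22 → Fin d₁ → ℝ)
    (x₂ : Fin 22 → Fin 22 → Fin d₂ → ℝ) (x₃ : Fin 22 → Fin 22 → Fin d₃ → ℝ)
    (η₁ η₂ η₃ : Fin 22 → ℝ) : BallModel :=
  let weight : Fin 22 → Bool → Fin 22 → ℝ := fun i s j =>
    bif s then Real.exp (γ ⬝ᵥ x₃ i j + η₃ j) else Real.exp (β ⬝ᵥ x₂ i j + η₂ j)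
  have weight_pos : ∀ i s j, 0 < weight i s j := by
    intro i s j
    cases s <;> exact Real.exp_pos _
  { team := team
    card_team := card_team
    rate := fun i => Real.exp (ω ⬝ᵥ c i)
    rate_pos := fun i => Real.exp_pos _
    success := fun i => Real.sigmoid (α ⬝ᵥ x₁ i + η₁ i)
    success_nonneg := fun i => Real.sigmoid_nonneg _
    success_le_one := fun i => Real.sigmoid_le_one _
    pass := fun i s j =>
      if j ∈ receivers team i s then weight i s j / ∑ k ∈ receivers team i s, weight i s k else 0
    pass_nonneg := by
      intro i s j
      split_ifs
      · exact div_nonneg (weight_pos i s j).le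
          (Finset.sum_nonneg fun k _ => (weight_pos i s k).le)
      · exact le_rfl
    pass_sum := by
      intro i s
      rw [Finset.sum_ite_mem, Finset.univ_inter, ← Finset.sum_div]
      exact div_self (Finset.sum_pos (fun k _ => weight_pos i s k)
        (receivers_nonempty team card_team i s)).ne'
    pass_failure_eq_zero := by
      intro i j h
      simp [receivers, h]
    pass_success_eq_zero := by
      intro i j h
      rw [if_neg]
      simp only [receivers, Finset.mem_filter, Finset.mem_univ, true_and]
      tauto }

end BallModel

/-- The random variables from which the ball-control process after a time `t₁` is built.
Possession `0` is the one in progress at time `t₁`; it began `age` time units before `t₁`.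
Player `holder m` has the ball during possession `m`, which lasts `hold m` time units and ends with
a pass to `holder (m + 1)`; `success m` tells whether that pass is a success (`S = 1`). -/
structure Possessions (Ω : Type*) where
  age : Ω → ℝ
  holder : ℕ → Ω → Fin 22
  hold : ℕ → Ω → ℝ
  success : ℕ → Ω → Bool

namespace Possessions

variable {Ω : Type*}

/-- The time at which possession `m` begins. -/
noncomputable def startTime (X : Possessions Ω) (t₁ : ℝ) (m : ℕ) (ω : Ω) : ℝ :=
  t₁ - X.age ω + ∑ k ∈ Finset.range m, X.hold k ω

/-- The player in control of the ball at time `t ≥ t₁`: the holder of the first possession that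
ends after time `t`. -/
noncomputable def control (X : Possessions Ω) (t₁ t : ℝ) (ω : Ω) : Fin 22 :=
  X.holder (sInf {m | t < X.startTime t₁ (m + 1) ω}) ω

/-- The information available when possession `m` begins: the past `𝓖` before the interval, the
earlier possessions, and the player who has just got the ball. -/
abbrev history (X : Possessions Ω) (𝓖 : MeasurableSpace Ω) (m : ℕ) : MeasurableSpace Ω :=
  𝓖 ⊔ (⨆ k ≤ m, MeasurableSpace.comap (X.holder k) ⊤) ⊔
    ⨆ k < m, (MeasurableSpace.comap (X.hold k) (borel ℝ) ⊔ MeasurableSpace.comap (X.success k) ⊤)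

/-- The information available at time `t`: the past `𝓖` before the interval and the player in
control of the ball at each time `s ∈ [t₁, t]`. -/
noncomputable abbrev past (X : Possessions Ω) (𝓖 : MeasurableSpace Ω) (t₁ t : ℝ) : MeasurableSpace Ω :=
  𝓖 ⊔ ⨆ s ∈ Icc t₁ t, MeasurableSpace.comap (X.control t₁ s) ⊤

end Possessions

/-- The law of the holding time of a possession in progress at the beginning of the interval: the
exponential distribution with rate `r`, given that the holding time exceeds `a ≥ 0`. -/
noncomputable def expMeasureExceeding (r a : ℝ) : Measure ℝ :=
  ProbabilityTheory.cond (expMeasure r) (Ioi a)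

/-- `X` describes the ball-control process during `[t₁, t₂)` with the time-invariant teams, rates
and probabilities of `M`. The player in control of the ball at time `t₁` and the age of this
player's possession are arbitrary, and so is the past `𝓖` to which they belong. Nothing is
required of possessions that begin, and of passes that are made, at time `t₂` or later. -/
structure IsBallControl {Ω : Type*} (𝓖 : MeasurableSpace Ω) [mΩ : MeasurableSpace Ω]
    (P : Measure Ω) (M : BallModel) (t₁ t₂ : ℝ) (X : Possessions Ω) : Prop where
  past_le : 𝓖 ≤ mΩ
  age_nonneg : ∀ ω, 0 ≤ X.age ω
  measurable_age : Measurable[𝓖] X.age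
  measurable_holder_zero : Measurable[𝓖] (X.holder 0)
  measurable_holder : ∀ m, Measurable[mΩ] (X.holder m)
  measurable_hold : ∀ m, Measurable[mΩ] (X.hold m)
  measurable_success : ∀ m, Measurable[mΩ] (X.success m)
  /-- The holding time of the possession in progress at time `t₁`. -/
  hold_zero_law : ∀ B : Set ℝ, MeasurableSet B → ∀ᵐ ω ∂P,
    (P⟦X.hold 0 ⁻¹' B | X.history 𝓖 0⟧) ω =
      (expMeasureExceeding (M.rate (X.holder 0 ω)) (X.age ω)).real B
  /-- The holding times of the possessions that begin in `[t₁, t₂)`. -/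
  hold_law : ∀ m, 1 ≤ m → ∀ B : Set ℝ, MeasurableSet B → ∀ᵐ ω ∂P, X.startTime t₁ m ω < t₂ →
    (P⟦X.hold m ⁻¹' B | X.history 𝓖 m⟧) ω = (expMeasure (M.rate (X.holder m ω))).real B
  /-- The pass that ends possession `m` is a success or a failure. -/
  success_law : ∀ m s, ∀ᵐ ω ∂P, X.startTime t₁ (m + 1) ω < t₂ →
    (P⟦X.success m ⁻¹' {s} |
      X.history 𝓖 m ⊔ MeasurableSpace.comap (X.hold m) (borel ℝ)⟧) ω =
      M.successProb (X.holder m ω) s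
  /-- The player who receives the pass that ends possession `m`. -/
  pass_law : ∀ m j, ∀ᵐ ω ∂P, X.startTime t₁ (m + 1) ω < t₂ →
    (P⟦X.holder (m + 1) ⁻¹' {j} |
      X.history 𝓖 m ⊔ MeasurableSpace.comap (X.hold m) (borel ℝ) ⊔
        MeasurableSpace.comap (X.success m) ⊤⟧) ω =
      M.pass (X.holder m ω) (X.success m ω) j

/-- `Y` is, on `[t₁, t₂)` and relative to the pasts `𝓕 t`, a right-continuous time-homogeneous
Markov process with generator matrix `Q`, i.e. with transition matrices `exp (h Q)`, `h ≥ 0`.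
The state space `ι` is finite and discrete, so right-continuity of a path at `t` means that the
path is constant on some `[t, t + ε)`. -/
structure IsMarkovWithGenerator {Ω ι : Type*} [mΩ : MeasurableSpace Ω] [Fintype ι] [DecidableEq ι]
    (P : Measure Ω) (𝓕 : ℝ → MeasurableSpace Ω) (t₁ t₂ : ℝ) (Y : ℝ → Ω → ι)
    (Q : Matrix ι ι ℝ) : Prop where
  offDiag_nonneg : ∀ i j, i ≠ j → 0 ≤ Q i j
  row_sum : ∀ i, ∑ j, Q i j = 0
  past_le : ∀ t ∈ Ico t₁ t₂, 𝓕 t ≤ mΩ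
  past_mono : ∀ s ∈ Ico t₁ t₂, ∀ t ∈ Ico t₁ t₂, s ≤ t → 𝓕 s ≤ 𝓕 t
  adapted : ∀ t ∈ Ico t₁ t₂, Measurable[𝓕 t, ⊤] (Y t)
  right_continuous : ∀ᵐ ω ∂P, ∀ t ∈ Ico t₁ t₂, ∀ᶠ s in 𝓝[≥] t, Y s ω = Y t ω
  markov : ∀ t ∈ Ico t₁ t₂, ∀ h, 0 ≤ h → t + h < t₂ → ∀ j,
    P⟦Y (t + h) ⁻¹' {j} | 𝓕 t⟧ =ᵐ[P] fun ω => NormedSpace.exp (h • Q) (Y t ω) j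

/-! ### Jump probabilities and the generator -/

namespace BallModel

/-! Write `E(h) = exp (h Q)`. With `Q = diag(rate) (jump - 1)`, the backward equation `E' = Q E`
integrates to the first-jump equation `BallModel.transition_eq`: either the current exponential
holding time outlasts `h`, or it ends at some `x ≤ h` and the chain restarts from the receiver with
time `h - x` left.

The process obeys the same recursion. Let possession `n` have base time `S` and holder `K`, and let
`E` be an event of its history on which the first `n` passes are made by `T < t₂`. The difference
between the integral of `E(T - S) K j` over `E` and `P(E, Y(T) = j)` is unchanged when `n` becomes
`n + 1` and `E` is cut down to the event that the next pass is also made by `T`. It is bounded by a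
constant times the probability of `n` passes by `T`. This decays geometrically in `n`, because each
residual holding time would have to be at most `T - t₁`. Hence the difference is zero
(`setIntegral_transition_baseTime_eq`); the transition probabilities are identified without a
uniqueness theorem for the integral equation.

For the Markov property at `t`, split according to the possession `m` in progress. There an event of
the past coincides with an event of the history of `m` (`exists_measurableSet_history_inter_eq`),
and the remaining holding time is again exponential by memorylessness (`map_remaining`). One
first-jump step from `t`, followed by the result above for possession `m + 1`, gives `E(h)`.

The holding and pass laws are only assumed before `t₂`, and holding times are only almost surely
nonnegative. Hence the argument runs on events `passesBy`, which bound every earlier start time and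
not just the last. -/

/-- The probability that a pass of player `i` is received by player `j`. -/
noncomputable def jump (M : BallModel) (i j : Fin 22) : ℝ :=
  ∑ s, M.successProb i s * M.pass i s j

theorem successProb_nonneg (M : BallModel) (i : Fin 22) (s : Bool) : 0 ≤ M.successProb i s := by
  cases s
  · simpa [successProb] using M.success_le_one i
  · simpa [successProb] using M.success_nonneg i

theorem jump_nonneg (M : BallModel) (i j : Fin 22) : 0 ≤ M.jump i j :=
  Finset.sum_nonneg fun s _ => mul_nonneg (M.successProb_nonneg i s) (M.pass_nonneg i s j)

theorem sum_jump (M : BallModel) (i : Fin 22) : ∑ j, M.jump i j = 1 := by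
  simp only [jump]
  rw [Finset.sum_comm]
  simp [← Finset.mul_sum, M.pass_sum, successProb]

/-- The two kinds of pass have disjoint sets of receivers, so at most one summand of `jump`
survives; neither does on the diagonal, as nobody passes to himself. -/
theorem generator_eq (M : BallModel) (i j : Fin 22) :
    M.generator i j = M.rate i * (M.jump i j - if i = j then 1 else 0) := by
  simp only [generator, Matrix.of_apply, jump, Fintype.sum_bool]
  split_ifs with h h'
  · subst h
    rw [M.pass_failure_eq_zero i i rfl, M.pass_success_eq_zero i i (Or.inl rfl)]
    ring
  · rw [M.pass_failure_eq_zero i j h']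
    ring
  · rw [M.pass_success_eq_zero i j (Or.inr h')]
    ring

theorem generator_nonneg (M : BallModel) {i j : Fin 22} (h : i ≠ j) : 0 ≤ M.generator i j := by
  rw [generator_eq, if_neg h, sub_zero]
  exact mul_nonneg (M.rate_pos i).le (M.jump_nonneg i j)

theorem sum_generator (M : BallModel) (i : Fin 22) : ∑ j, M.generator i j = 0 := by
  simp [generator_eq, ← Finset.mul_sum, Finset.sum_sub_distrib, M.sum_jump]

end BallModel

/-! ### Transition matrices and the backward equation -/

section MatrixExponential

attribute [local instance] Matrix.linftyOpNormedRing Matrix.linftyOpNormedAlgebra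

theorem Matrix.hasDerivAt_exp_smul_apply {ι : Type*} [Fintype ι] [DecidableEq ι]
    (Q : Matrix ι ι ℝ) (i j : ι) (t : ℝ) :
    HasDerivAt (fun h : ℝ => NormedSpace.exp (h • Q) i j)
      ((Q * NormedSpace.exp (t • Q)) i j) t := by
  have h := hasDerivAt_exp_smul_const' (𝕂 := ℝ) Q t
  exact ((Matrix.entryLinearMap ℝ ℝ i j).toContinuousLinearMap.hasFDerivAt.comp_hasDerivAt t h)

end MatrixExponential

theorem Matrix.continuous_exp_smul_apply {ι : Type*} [Fintype ι] [DecidableEq ι]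
    (Q : Matrix ι ι ℝ) (i j : ι) : Continuous fun h : ℝ => NormedSpace.exp (h • Q) i j :=
  continuous_iff_continuousAt.2 fun t => (Q.hasDerivAt_exp_smul_apply i j t).continuousAt

/-- The first-order Taylor remainder of the exponential at `0`. It involves no time `t`, whence the
uniformity of the `o(h)` term. -/
theorem Matrix.exp_smul_apply_sub_isLittleO {ι : Type*} [Fintype ι] [DecidableEq ι]
    (Q : Matrix ι ι ℝ) (i j : ι) :
    (fun h : ℝ => NormedSpace.exp (h • Q) i j - (if i = j then 1 else 0) - Q i j * h)
      =o[𝓝[>] 0] fun h => h := by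
  have h := (Q.hasDerivAt_exp_smul_apply i j 0).isLittleO
  simp only [zero_smul, NormedSpace.exp_zero, mul_one, sub_zero, Matrix.one_apply,
    smul_eq_mul] at h
  refine (h.mono nhdsWithin_le_nhds).congr_left fun x => ?_
  ring

theorem BallModel.generator_mul_apply (M : BallModel) (E : Matrix (Fin 22) (Fin 22) ℝ)
    (i j : Fin 22) :
    (M.generator * E) i j = M.rate i * (∑ k, M.jump i k * E k j - E i j) := by
  simp only [Matrix.mul_apply, generator_eq, mul_assoc, ← Finset.mul_sum, sub_mul,
    Finset.sum_sub_distrib, ite_mul, one_mul, zero_mul, Finset.sum_ite_eq, Finset.mem_univ, if_true]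

/-- First-jump decomposition of the transition matrices. -/
theorem BallModel.transition_eq (M : BallModel) (i j : Fin 22) (c : ℝ) :
    NormedSpace.exp (c • M.generator) i j =
      Real.exp (-(M.rate i * c)) * (if i = j then 1 else 0) +
      ∫ x in (0 : ℝ)..c, M.rate i * Real.exp (-(M.rate i * x)) *
        ∑ k, M.jump i k * NormedSpace.exp ((c - x) • M.generator) k j := by
  have hcont : ∀ k, Continuous fun x : ℝ => NormedSpace.exp ((c - x) • M.generator) k j :=
    fun k => (M.generator.continuous_exp_smul_apply k j).comp (continuous_const.sub continuous_id)
  -- Integrating factor: in the derivative of `exp (-λx) E(c - x) i j`, with `λ` the rate of `i`,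
  -- the terms containing `E(c - x) i j` cancel and only the jump term remains.
  have hderiv : ∀ x ∈ uIcc 0 c, HasDerivAt
      (fun x => -(Real.exp (-(M.rate i * x)) * NormedSpace.exp ((c - x) • M.generator) i j))
      (M.rate i * Real.exp (-(M.rate i * x)) *
        ∑ k, M.jump i k * NormedSpace.exp ((c - x) • M.generator) k j) x := by
    intro x _
    have h1 : HasDerivAt (fun x => Real.exp (-(M.rate i * x)))
        (Real.exp (-(M.rate i * x)) * -(M.rate i * 1)) x :=
      (((hasDerivAt_id x).const_mul (M.rate i)).neg).exp
    have h2 : HasDerivAt (fun x => NormedSpace.exp ((c - x) • M.generator) i j)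
        (M.rate i * (∑ k, M.jump i k * NormedSpace.exp ((c - x) • M.generator) k j -
          NormedSpace.exp ((c - x) • M.generator) i j) * -1) x := by
      have h := M.generator.hasDerivAt_exp_smul_apply i j (c - x)
      rw [generator_mul_apply] at h
      exact h.comp x ((hasDerivAt_id x).const_sub c)
    refine (h1.mul h2).neg.congr_deriv ?_
    ring
  rw [intervalIntegral.integral_eq_sub_of_hasDerivAt hderiv]
  · simp [Matrix.one_apply]
  · refine Continuous.intervalIntegrable ?_ _ _
    exact (by fun_prop : Continuous fun x => M.rate i * Real.exp (-(M.rate i * x))).mul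
      (continuous_finsetSum _ fun k _ => continuous_const.mul (hcont k))

/-! ### Exponential distributions -/

section Exponential

variable {r : ℝ}

theorem expMeasure_apply (r : ℝ) {C : Set ℝ} (hC : MeasurableSet C) :
    expMeasure r C = ∫⁻ x, C.indicator (exponentialPDF r) x := by
  rw [expMeasure, gammaMeasure, withDensity_apply _ hC, lintegral_indicator hC]
  rfl

/-- The exponential distribution is memoryless. -/
theorem expMeasure_memoryless (r : ℝ) {c : ℝ} (hc : 0 ≤ c) {C : Set ℝ} (hC : MeasurableSet C) :
    expMeasure r {x | c < x ∧ x - c ∈ C} =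
      ENNReal.ofReal (Real.exp (-(r * c))) * expMeasure r C := by
  have hm : MeasurableSet {x : ℝ | c < x ∧ x - c ∈ C} :=
    measurableSet_Ioi.inter ((measurable_id.sub_const c) hC)
  have hmeas : Measurable (exponentialPDF r) := (measurable_exponentialPDFReal r).ennreal_ofReal
  rw [expMeasure_apply r hm, expMeasure_apply r hC, ← lintegral_const_mul _ (hmeas.indicator hC),
    ← lintegral_add_right_eq_self _ c]
  refine lintegral_congr_ae ?_
  -- At `y = 0` the strict inequality `c < x` fails although the density need not vanish there.
  have h0 : ∀ᵐ y : ℝ, y ≠ 0 := by simp [ae_iff]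
  filter_upwards [h0] with y hy
  by_cases hyC : y ∈ C
  · rcases lt_or_gt_of_ne hy with h | h
    · rw [indicator_of_notMem, indicator_of_mem hyC, exponentialPDF_of_neg h, mul_zero]
      simp only [mem_ofPred_eq, not_and]
      intro h'
      linarith
    · rw [indicator_of_mem, indicator_of_mem hyC, exponentialPDF_of_nonneg h.le,
        exponentialPDF_of_nonneg (by linarith), ← ENNReal.ofReal_mul (Real.exp_pos _).le]
      · congr 1
        rw [mul_left_comm, ← Real.exp_add]
        congr 2
        ring
      · exact ⟨by linarith, by simpa using hyC⟩
  · rw [indicator_of_notMem, indicator_of_notMem hyC, mul_zero]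
    simp [hyC]

theorem expMeasure_Ioi (hr : 0 < r) {c : ℝ} (hc : 0 ≤ c) :
    expMeasure r (Ioi c) = ENNReal.ofReal (Real.exp (-(r * c))) := by
  have := isProbabilityMeasure_expMeasure hr
  have h := expMeasure_memoryless r hc MeasurableSet.univ
  simpa [Ioi] using h

theorem expMeasure_Iio_zero (r : ℝ) : expMeasure r (Iio 0) = 0 := by
  rw [expMeasure, gammaMeasure, withDensity_apply _ measurableSet_Iio]
  exact lintegral_exponentialPDF_of_nonpos le_rfl

theorem expMeasure_real_Iic (hr : 0 < r) {c : ℝ} (hc : 0 ≤ c) :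
    (expMeasure r).real (Iic c) = 1 - Real.exp (-(r * c)) := by
  have := isProbabilityMeasure_expMeasure hr
  rw [← compl_Ioi, probReal_compl_eq_one_sub measurableSet_Ioi, measureReal_def,
    expMeasure_Ioi hr hc, ENNReal.toReal_ofReal (Real.exp_pos _).le]

/-- By memorylessness, conditioning on exceeding `a` yields the law of `a` plus a fresh exponential
time. -/
theorem expMeasureExceeding_apply (hr : 0 < r) {a : ℝ} (ha : 0 ≤ a) {C : Set ℝ}
    (hC : MeasurableSet C) :
    expMeasureExceeding r a C = expMeasure r {x | x + a ∈ C} := by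
  rw [expMeasureExceeding, cond_apply measurableSet_Ioi, expMeasure_Ioi hr ha]
  have h := expMeasure_memoryless r ha (C := {x | x + a ∈ C}) ((measurable_id.add_const a) hC)
  have hset : {x : ℝ | a < x ∧ x - a ∈ {x | x + a ∈ C}} = Ioi a ∩ C := by
    ext x
    simp
  rw [← hset, h, ← mul_assoc, ENNReal.inv_mul_cancel, one_mul]
  · simp [Real.exp_pos]
  · simp

theorem setIntegral_expMeasure_Iic (hr : 0 < r) {c : ℝ} (hc : 0 ≤ c) (f : ℝ → ℝ) :
    ∫ x in Iic c, f x ∂expMeasure r =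
      ∫ x in (0 : ℝ)..c, r * Real.exp (-(r * x)) * f x := by
  have hmeas : Measurable (exponentialPDF r) := (measurable_exponentialPDFReal r).ennreal_ofReal
  have hlt : ∀ᵐ x : ℝ ∂volume.restrict (Iic c), exponentialPDF r x < ⊤ :=
    Eventually.of_forall fun x => ENNReal.ofReal_lt_top
  change ∫ x in Iic c, f x ∂(volume.withDensity (exponentialPDF r)) = _
  rw [restrict_withDensity measurableSet_Iic,
    integral_withDensity_eq_integral_toReal_smul hmeas hlt, intervalIntegral.integral_of_le hc,
    ← integral_Icc_eq_integral_Ioc, ← integral_indicator measurableSet_Iic,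
    ← integral_indicator measurableSet_Icc]
  congr 1
  ext x
  by_cases hx : x ≤ c
  · by_cases h0 : 0 ≤ x
    · rw [indicator_of_mem (by exact hx), indicator_of_mem (by exact ⟨h0, hx⟩),
        exponentialPDF_of_nonneg h0, ENNReal.toReal_ofReal (by positivity), smul_eq_mul]
    · rw [indicator_of_mem (by exact hx), indicator_of_notMem (fun h => h0 h.1),
        exponentialPDF_of_neg (not_le.1 h0)]
      simp
  · rw [indicator_of_notMem (by exact hx), indicator_of_notMem (fun h => hx h.2)]

end Exponential

/-- Continuity on a compact interval suffices; that the matrices are stochastic is not needed. -/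
theorem BallModel.exists_transition_bound (M : BallModel) (c : ℝ) :
    ∃ C, 0 ≤ C ∧ ∀ i j, ∀ h ∈ Icc 0 c, |NormedSpace.exp (h • M.generator) i j| ≤ C := by
  choose C hC using fun i j => (isCompact_Icc (a := (0 : ℝ)) (b := c)).exists_bound_of_continuousOn
    (M.generator.continuous_exp_smul_apply i j).continuousOn
  refine ⟨∑ i, ∑ j, |C i j|, by positivity, fun i j h hh => ?_⟩
  calc |NormedSpace.exp (h • M.generator) i j| ≤ |C i j| := (hC i j h hh).trans (le_abs_self _)
    _ ≤ ∑ j, |C i j| := Finset.single_le_sum (f := fun j => |C i j|)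
        (fun _ _ => abs_nonneg _) (Finset.mem_univ j)
    _ ≤ ∑ i, ∑ j, |C i j| := Finset.single_le_sum (f := fun i => ∑ j, |C i j|)
        (fun _ _ => Finset.sum_nonneg fun _ _ => abs_nonneg _) (Finset.mem_univ i)

theorem MeasureTheory.setIntegral_eq_sum_inter_preimage {Ω ι : Type*} [MeasurableSpace Ω]
    [Fintype ι] [MeasurableSpace ι] [MeasurableSingletonClass ι] {μ : Measure Ω} {s : Set Ω}
    (hs : MeasurableSet s) {K : Ω → ι} (hK : Measurable K) {f : Ω → ℝ} (hf : IntegrableOn f s μ) :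
    ∫ ω in s, f ω ∂μ = ∑ k, ∫ ω in s ∩ K ⁻¹' {k}, f ω ∂μ := by
  have hU : s = ⋃ k ∈ (Finset.univ : Finset ι), s ∩ K ⁻¹' {k} := by
    ext ω
    simp
  conv_lhs => rw [hU]
  refine integral_biUnion_finset _ (fun k _ => hs.inter (hK (measurableSet_singleton k))) ?_
    (fun k _ => hf.mono_set inter_subset_left)
  intro k _ l _ hkl
  rw [Function.onFun, Set.disjoint_left]
  rintro ω ⟨_, rfl⟩ ⟨_, h⟩
  exact hkl h

/-! ### First-jump decomposition for a random possession -/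

section FirstJump

variable {Ω : Type*} [MeasurableSpace Ω] {μ : Measure Ω}

theorem ae_le_of_map_eq_prod_expMeasure {r : ℝ} (hr : 0 < r) {S N : Ω → ℝ} (hS : Measurable S)
    (hN : Measurable N)
    (hlaw : μ.map (fun ω => (S ω, N ω - S ω)) = (μ.map S).prod (expMeasure r)) :
    ∀ᵐ ω ∂μ, S ω ≤ N ω := by
  have := isProbabilityMeasure_expMeasure hr
  have hpair : Measurable fun ω => (S ω, N ω - S ω) := hS.prodMk (hN.sub hS)
  have h : μ.map (fun ω => (S ω, N ω - S ω)) (univ ×ˢ Iio 0) = 0 := by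
    rw [hlaw, Measure.prod_prod, expMeasure_Iio_zero, mul_zero]
  rw [Measure.map_apply hpair (MeasurableSet.univ.prod measurableSet_Iio)] at h
  rw [ae_iff]
  convert h using 2
  ext ω
  simp

/-- The hypothesis makes the image under `N` of the measure restricted to `B` proportional to the
unrestricted image, up to time `T`. -/
theorem setIntegral_comp_eq_of_measure_inter [IsFiniteMeasure μ] {N : Ω → ℝ} {B : Set Ω}
    {T p : ℝ} (hp : 0 ≤ p)
    (hN : Measurable N)
    (h : ∀ C : Set ℝ, MeasurableSet C → C ⊆ Iic T →
      μ.real (N ⁻¹' C ∩ B) = p * μ.real (N ⁻¹' C)) {f : ℝ → ℝ} (hf : Continuous f) :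
    ∫ ω in N ⁻¹' Iic T ∩ B, f (N ω) ∂μ = p * ∫ ω in N ⁻¹' Iic T, f (N ω) ∂μ := by
  have hmap : (μ.restrict (N ⁻¹' Iic T ∩ B)).map N =
      ENNReal.ofReal p • (μ.restrict (N ⁻¹' Iic T)).map N := by
    ext C hC
    have h' := h (C ∩ Iic T) (hC.inter measurableSet_Iic) inter_subset_right
    rw [Measure.smul_apply, Measure.map_apply hN hC, Measure.map_apply hN hC,
      Measure.restrict_apply (hN hC), Measure.restrict_apply (hN hC), ← inter_assoc,
      ← preimage_inter, smul_eq_mul, ← ofReal_measureReal, h', ENNReal.ofReal_mul hp,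
      ofReal_measureReal]
  rw [← integral_map hN.aemeasurable hf.aestronglyMeasurable, hmap, integral_smul_measure,
    ENNReal.toReal_ofReal hp, integral_map hN.aemeasurable hf.aestronglyMeasurable, smul_eq_mul]

/-- First-jump decomposition of the transition probabilities for a possession of player `i` which
lasts from the random time `S` to the random time `N` and ends with a pass to player `K`. -/
theorem BallModel.integral_transition_eq [IsFiniteMeasure μ] (M : BallModel) (i j : Fin 22)
    {S N : Ω → ℝ}
    {K : Ω → Fin 22} (hS : Measurable S) (hN : Measurable N) (hK : Measurable K)
    (hlaw : μ.map (fun ω => (S ω, N ω - S ω)) = (μ.map S).prod (expMeasure (M.rate i)))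
    {s₀ T : ℝ} (hS₀ : ∀ᵐ ω ∂μ, s₀ ≤ S ω) (hST : ∀ᵐ ω ∂μ, S ω ≤ T)
    (hpass : ∀ k, ∀ C : Set ℝ, MeasurableSet C → C ⊆ Iic T →
      μ.real (N ⁻¹' C ∩ K ⁻¹' {k}) = M.jump i k * μ.real (N ⁻¹' C)) :
    ∫ ω, NormedSpace.exp ((T - S ω) • M.generator) i j ∂μ =
      (if i = j then 1 else 0) * μ.real (N ⁻¹' Ioi T) +
        ∫ ω in N ⁻¹' Iic T, NormedSpace.exp ((T - N ω) • M.generator) (K ω) j ∂μ := by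
  have := isProbabilityMeasure_expMeasure (M.rate_pos i)
  obtain ⟨C, hC0, hC⟩ := M.exists_transition_bound (T - s₀)
  have hGcont : ∀ k, Continuous fun u : ℝ => NormedSpace.exp ((T - u) • M.generator) k j :=
    fun k => (M.generator.continuous_exp_smul_apply k j).comp (continuous_const.sub continuous_id)
  set H : ℝ → ℝ := fun u => ∑ k, M.jump i k * NormedSpace.exp ((T - u) • M.generator) k j with hH
  have hHcont : Continuous H := continuous_finsetSum _ fun k _ => continuous_const.mul (hGcont k)
  have hNS : ∀ᵐ ω ∂μ, s₀ ≤ N ω := by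
    filter_upwards [ae_le_of_map_eq_prod_expMeasure (M.rate_pos i) hS hN hlaw, hS₀] with ω h1 h2
    exact h2.trans h1
  have hint : ∀ k, IntegrableOn (fun ω => NormedSpace.exp ((T - N ω) • M.generator) k j)
      (N ⁻¹' Iic T) μ := by
    intro k
    refine Integrable.of_bound ((hGcont k).measurable.comp hN).aestronglyMeasurable C ?_
    rw [ae_restrict_iff' (hN measurableSet_Iic)]
    filter_upwards [hNS] with ω h1 h2
    exact hC k j _ ⟨sub_nonneg.2 h2, sub_le_sub_left h1 _⟩
  have hintK : IntegrableOn (fun ω => NormedSpace.exp ((T - N ω) • M.generator) (K ω) j)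
      (N ⁻¹' Iic T) μ := by
    refine Integrable.of_bound (Measurable.aestronglyMeasurable ?_) C ?_
    · have : Measurable fun p : Fin 22 × ℝ => NormedSpace.exp ((T - p.2) • M.generator) p.1 j :=
        measurable_from_prod_countable_right fun k => (hGcont k).measurable
      exact this.comp (hK.prodMk hN)
    rw [ae_restrict_iff' (hN measurableSet_Iic)]
    filter_upwards [hNS] with ω h1 h2
    exact hC (K ω) j _ ⟨sub_nonneg.2 h2, sub_le_sub_left h1 _⟩
  -- On `N ≤ T` the receiver has law `jump i` whatever the value of `N`, so it can be averaged out.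
  have hpassed : ∫ ω in N ⁻¹' Iic T, NormedSpace.exp ((T - N ω) • M.generator) (K ω) j ∂μ =
      ∫ ω in N ⁻¹' Iic T, H (N ω) ∂μ := by
    rw [setIntegral_eq_sum_inter_preimage (hN measurableSet_Iic) hK hintK, hH,
      integral_finsetSum _ fun k _ => (hint k).const_mul _]
    refine Finset.sum_congr rfl fun k _ => ?_
    rw [integral_const_mul, ← setIntegral_comp_eq_of_measure_inter (M.jump_nonneg i k) hN
      (hpass k) (hGcont k)]
    refine setIntegral_congr_fun ((hN measurableSet_Iic).inter (hK (measurableSet_singleton k)))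
      fun ω hω => ?_
    have : K ω = k := hω.2
    simp only [this]
  set δ : ℝ := if i = j then 1 else 0
  -- Both outcomes, still holding at `T` or already passed, become one function of `(S, N - S)`, to
  -- which the product law and Fubini apply.
  set Φ : ℝ × ℝ → ℝ := fun p => if p.1 + p.2 ≤ T then H (p.1 + p.2) else δ with hΦ
  have hΦmeas : Measurable Φ :=
    Measurable.ite (measurableSet_le (measurable_fst.add measurable_snd) measurable_const)
      (hHcont.measurable.comp (measurable_fst.add measurable_snd)) measurable_const
  have hpair : Measurable fun ω => (S ω, N ω - S ω) := hS.prodMk (hN.sub hS)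
  have hΦcomp : ∀ ω, Φ (S ω, N ω - S ω) =
      (N ⁻¹' Ioi T).indicator (fun _ => δ) ω + (N ⁻¹' Iic T).indicator (fun ω => H (N ω)) ω := by
    intro ω
    by_cases h : N ω ≤ T
    · simp [hΦ, h]
    · simp [hΦ, h, not_le.1 h]
  have hHint : IntegrableOn (fun ω => H (N ω)) (N ⁻¹' Iic T) μ :=
    integrable_finsetSum _ fun k _ => (hint k).const_mul _
  have hi1 : Integrable ((N ⁻¹' Ioi T).indicator (fun _ => δ)) μ :=
    (integrable_const δ).indicator (hN measurableSet_Ioi)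
  have hi2 : Integrable ((N ⁻¹' Iic T).indicator (fun ω => H (N ω))) μ :=
    (integrable_indicator_iff (hN measurableSet_Iic)).2 hHint
  have hΦint : Integrable Φ ((μ.map S).prod (expMeasure (M.rate i))) := by
    rw [← hlaw, integrable_map_measure hΦmeas.aestronglyMeasurable hpair.aemeasurable]
    refine (hi1.add hi2).congr (Eventually.of_forall fun ω => ?_)
    exact (hΦcomp ω).symm
  have hsum : δ * μ.real (N ⁻¹' Ioi T) + ∫ ω in N ⁻¹' Iic T, H (N ω) ∂μ =
      ∫ ω, Φ (S ω, N ω - S ω) ∂μ := by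
    simp_rw [hΦcomp]
    rw [integral_add hi1 hi2, integral_indicator (hN measurableSet_Ioi),
      integral_indicator (hN measurableSet_Iic), setIntegral_const, smul_eq_mul, mul_comm]
  rw [hpassed, hsum, ← integral_map hpair.aemeasurable hΦmeas.aestronglyMeasurable, hlaw,
    integral_prod _ hΦint, ← integral_map hS.aemeasurable
      (hGcont i).aestronglyMeasurable (f := fun u => NormedSpace.exp ((T - u) • M.generator) i j)]
  have hST' : ∀ᵐ s ∂μ.map S, s ≤ T := (ae_map_iff hS.aemeasurable measurableSet_Iic).2 hST
  refine integral_congr_ae ?_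
  -- For fixed `S = s` the inner integral is the first-jump equation with time `T - s` left.
  filter_upwards [hST'] with s hs
  have hc : 0 ≤ T - s := sub_nonneg.2 hs
  have hsplit : ∀ x, Φ (s, x) = (Ioi (T - s)).indicator (fun _ => δ) x +
      (Iic (T - s)).indicator (fun x => H (s + x)) x := by
    intro x
    by_cases h : s + x ≤ T
    · have h' : x ≤ T - s := by linarith
      simp [hΦ, h, h']
    · have h' : ¬ x ≤ T - s := by linarith
      simp [hΦ, h, h', not_le.1 h']
  have hj2 : IntegrableOn (fun x => H (s + x)) (Iic (T - s)) (expMeasure (M.rate i)) := by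
    obtain ⟨D, hD⟩ := (isCompact_Icc (a := s) (b := T)).exists_bound_of_continuousOn
      hHcont.continuousOn
    refine Integrable.of_bound
      (hHcont.comp (continuous_const.add continuous_id)).aestronglyMeasurable D ?_
    rw [ae_restrict_iff' measurableSet_Iic]
    have h0 : ∀ᵐ x ∂expMeasure (M.rate i), 0 ≤ x := by
      rw [ae_iff]
      simpa [Iio] using expMeasure_Iio_zero (M.rate i)
    filter_upwards [h0] with x h1 h2
    refine hD _ ⟨by linarith, ?_⟩
    have : x ≤ T - s := h2
    linarith
  simp_rw [hsplit]
  rw [integral_add ((integrable_const δ).indicator measurableSet_Ioi)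
    ((integrable_indicator_iff measurableSet_Iic).2 hj2), integral_indicator measurableSet_Ioi,
    integral_indicator measurableSet_Iic, setIntegral_const, smul_eq_mul,
    setIntegral_expMeasure_Iic (M.rate_pos i) hc, measureReal_def,
    expMeasure_Ioi (M.rate_pos i) hc, ENNReal.toReal_ofReal (Real.exp_pos _).le,
    M.transition_eq i j (T - s)]
  simp only [hH, sub_add_eq_sub_sub]
  rfl

end FirstJump

/-- The defining property of conditional probability. The formula is required on `C` only, which
accommodates laws that hold only before `t₂`. -/
theorem measure_inter_eq_setLIntegral_of_condExp {Ω : Type*} {m mΩ : MeasurableSpace Ω}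
    {P : Measure Ω} [IsFiniteMeasure P] (hm : m ≤ mΩ) {A C : Set Ω} (hA : MeasurableSet A)
    (hC : MeasurableSet[m] C) {f : Ω → ENNReal}
    (h : ∀ᵐ ω ∂P, ω ∈ C → ENNReal.ofReal ((P⟦A | m⟧) ω) = f ω) :
    P (C ∩ A) = ∫⁻ ω in C, f ω ∂P := by
  have hC' : MeasurableSet C := hm C hC
  have hint : Integrable (A.indicator fun _ => (1 : ℝ)) P := (integrable_const 1).indicator hA
  have hnonneg : 0 ≤ᵐ[P] P⟦A | m⟧ :=
    condExp_nonneg (Eventually.of_forall fun ω => indicator_nonneg (fun _ _ => zero_le_one) ω)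
  rw [← setLIntegral_congr_fun_ae hC' h,
    ← ofReal_integral_eq_lintegral_ofReal integrable_condExp.integrableOn
      (ae_restrict_of_ae hnonneg), setIntegral_condExp hm hint hC, integral_indicator hA,
    Measure.restrict_restrict hA, setIntegral_const, smul_eq_mul, mul_one, ofReal_measureReal,
    inter_comm]

/-! ### Start times and histories of possessions -/

namespace Possessions

variable {Ω : Type*} (X : Possessions Ω) (t₁ : ℝ)

/-- The later of the time `t₁` and the time at which possession `m` begins. -/
noncomputable def baseTime (m : ℕ) (ω : Ω) : ℝ :=
  if m = 0 then t₁ else X.startTime t₁ m ω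

/-- The event that the first `m` passes are made by time `t`. -/
def passesBy (t : ℝ) (m : ℕ) : Set Ω := {ω | ∀ k < m, X.startTime t₁ (k + 1) ω ≤ t}

theorem startTime_succ (m : ℕ) (ω : Ω) :
    X.startTime t₁ (m + 1) ω = X.startTime t₁ m ω + X.hold m ω := by
  simp only [startTime, Finset.sum_range_succ]
  ring

theorem passesBy_succ (t : ℝ) (m : ℕ) :
    X.passesBy t₁ t (m + 1) = X.passesBy t₁ t m ∩ {ω | X.startTime t₁ (m + 1) ω ≤ t} := by
  ext ω
  simp only [passesBy, mem_ofPred_eq, mem_inter_iff, Nat.lt_succ_iff_lt_or_eq]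
  constructor
  · exact fun h => ⟨fun k hk => h k (Or.inl hk), h m (Or.inr rfl)⟩
  · rintro ⟨h1, h2⟩ k (hk | rfl)
    exacts [h1 k hk, h2]

theorem passesBy_antitone (t : ℝ) : Antitone (X.passesBy t₁ t) :=
  fun _ _ hmn _ h k hk => h k (hk.trans_le hmn)

theorem baseTime_le {t : ℝ} (ht : t₁ ≤ t) {m : ℕ} {ω : Ω} (h : ω ∈ X.passesBy t₁ t m) :
    X.baseTime t₁ m ω ≤ t := by
  rcases m with _ | m
  · simpa [baseTime] using ht
  · simpa [baseTime] using h m (Nat.lt_succ_self m)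

section History

variable (𝓖 : MeasurableSpace Ω)

theorem past_le_history (m : ℕ) : 𝓖 ≤ X.history 𝓖 m :=
  le_trans le_sup_left le_sup_left

theorem history_mono : Monotone (X.history 𝓖) := by
  intro m n hmn
  refine sup_le_sup (sup_le_sup le_rfl ?_) ?_
  · exact iSup₂_mono' fun k hk => ⟨k, hk.trans hmn, le_rfl⟩
  · exact iSup₂_mono' fun k hk => ⟨k, hk.trans_le hmn, le_rfl⟩

theorem measurable_holder_history (m : ℕ) : Measurable[X.history 𝓖 m] (X.holder m) := by
  refine Measurable.of_comap_le ?_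
  exact le_trans (le_trans (le_iSup₂_of_le (f := fun k (_ : k ≤ m) =>
    MeasurableSpace.comap (X.holder k) ⊤) m le_rfl le_rfl) le_sup_right) le_sup_left

theorem comap_hold_le_history {k m : ℕ} (h : k < m) :
    MeasurableSpace.comap (X.hold k) (borel ℝ) ≤ X.history 𝓖 m :=
  (le_iSup₂_of_le (f := fun k (_ : k < m) => MeasurableSpace.comap (X.hold k) (borel ℝ) ⊔
    MeasurableSpace.comap (X.success k) ⊤) k h le_sup_left).trans le_sup_right

theorem measurable_hold_history {k m : ℕ} (h : k < m) : Measurable[X.history 𝓖 m] (X.hold k) := by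
  refine Measurable.of_comap_le ?_
  rw [BorelSpace.measurable_eq (α := ℝ)]
  exact X.comap_hold_le_history 𝓖 h

theorem history_sup_hold_le (m : ℕ) :
    X.history 𝓖 m ⊔ MeasurableSpace.comap (X.hold m) (borel ℝ) ≤ X.history 𝓖 (m + 1) :=
  sup_le (X.history_mono 𝓖 m.le_succ) (X.comap_hold_le_history 𝓖 m.lt_succ_self)

end History

end Possessions

/-! ### Laws of residual holding times and of passes -/

namespace IsBallControl

open Possessions

variable {Ω : Type*} {𝓖 : MeasurableSpace Ω} [mΩ : MeasurableSpace Ω] {P : Measure Ω}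
  {M : BallModel} {t₁ t₂ : ℝ} {X : Possessions Ω} (hX : IsBallControl 𝓖 P M t₁ t₂ X)

include hX

theorem history_le (m : ℕ) : X.history 𝓖 m ≤ mΩ := by
  refine sup_le (sup_le hX.past_le (iSup₂_le fun k _ => ?_)) (iSup₂_le fun k _ => sup_le ?_ ?_)
  · exact (hX.measurable_holder k).comap_le
  · rw [← BorelSpace.measurable_eq (α := ℝ)]
    exact (hX.measurable_hold k).comap_le
  · exact (hX.measurable_success k).comap_le

theorem measurable_startTime_history (m : ℕ) : Measurable[X.history 𝓖 m] (X.startTime t₁ m) := by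
  refine Measurable.add ?_ (Finset.measurable_sum _ fun k hk => ?_)
  · exact measurable_const.sub (hX.measurable_age.mono (X.past_le_history 𝓖 m) le_rfl)
  · exact X.measurable_hold_history 𝓖 (Finset.mem_range.1 hk)

theorem measurable_startTime (m : ℕ) : Measurable (X.startTime t₁ m) :=
  (hX.measurable_startTime_history m).mono (hX.history_le m) le_rfl

theorem measurable_baseTime_history (m : ℕ) : Measurable[X.history 𝓖 m] (X.baseTime t₁ m) := by
  rcases m with _ | m
  · exact measurable_const
  · exact hX.measurable_startTime_history (m + 1)

theorem measurable_baseTime (m : ℕ) : Measurable (X.baseTime t₁ m) :=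
  (hX.measurable_baseTime_history m).mono (hX.history_le m) le_rfl

theorem measurable_startTime_succ_sup (m : ℕ) :
    Measurable[X.history 𝓖 m ⊔ MeasurableSpace.comap (X.hold m) (borel ℝ)]
      (X.startTime t₁ (m + 1)) := by
  have h : X.startTime t₁ (m + 1) = fun ω => X.startTime t₁ m ω + X.hold m ω :=
    funext fun ω => X.startTime_succ t₁ m ω
  rw [h]
  refine Measurable.add ((hX.measurable_startTime_history m).mono le_sup_left le_rfl) ?_
  refine Measurable.of_comap_le ?_
  rw [BorelSpace.measurable_eq (α := ℝ)]
  exact le_sup_right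

theorem measurableSet_passesBy (t : ℝ) (m : ℕ) :
    MeasurableSet[X.history 𝓖 m] (X.passesBy t₁ t m) := by
  induction m with
  | zero => simp [passesBy]
  | succ m ih =>
    rw [passesBy_succ]
    exact MeasurableSet.inter (X.history_mono 𝓖 m.le_succ _ ih)
      (hX.measurable_startTime_history (m + 1) measurableSet_Iic)

variable [IsProbabilityMeasure P]

/-- Given the past, `hold 0` is the age plus an independent exponential time. The joint law is
needed because the residual time subtracts a random age, while `hold_zero_law` treats one fixed set
at a time. -/
theorem map_age_hold_zero {i : Fin 22} {B : Set Ω} (hB : MeasurableSet[X.history 𝓖 0] B)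
    (hBi : B ⊆ X.holder 0 ⁻¹' {i}) :
    (P.restrict B).map (fun ω => (X.age ω, X.hold 0 ω)) =
      (((P.restrict B).map X.age).prod (expMeasure (M.rate i))).map
        fun p => (p.1, p.2 + p.1) := by
  have := isProbabilityMeasure_expMeasure (M.rate_pos i)
  have hage : Measurable X.age := hX.measurable_age.mono hX.past_le le_rfl
  refine Measure.ext_prod fun {s u} hs hu => ?_
  have hsh : Measurable fun p : ℝ × ℝ => (p.1, p.2 + p.1) := by fun_prop
  have hpair : Measurable fun ω => (X.age ω, X.hold 0 ω) := hage.prodMk (hX.measurable_hold 0)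
  have hBs : MeasurableSet[X.history 𝓖 0] (B ∩ X.age ⁻¹' s) :=
    MeasurableSet.inter hB
      ((hX.measurable_age.mono (X.past_le_history 𝓖 0) le_rfl) hs)
  have h1 : P ((B ∩ X.age ⁻¹' s) ∩ X.hold 0 ⁻¹' u) =
      ∫⁻ ω in B ∩ X.age ⁻¹' s, expMeasure (M.rate i) {x | x + X.age ω ∈ u} ∂P := by
    refine measure_inter_eq_setLIntegral_of_condExp (hX.history_le 0) (hX.measurable_hold 0 hu) hBs
      ?_
    filter_upwards [hX.hold_zero_law u hu] with ω hω hmem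
    have hi : X.holder 0 ω = i := hBi hmem.1
    rw [hω, hi, ← expMeasureExceeding_apply (M.rate_pos i) (hX.age_nonneg ω) hu]
    have : IsFiniteMeasure (expMeasureExceeding (M.rate i) (X.age ω)) :=
      inferInstanceAs (IsFiniteMeasure (ProbabilityTheory.cond _ _))
    exact ofReal_measureReal
  have hms : MeasurableSet ((fun p : ℝ × ℝ => (p.1, p.2 + p.1)) ⁻¹' s ×ˢ u) := hsh (hs.prod hu)
  rw [Measure.map_apply hpair (hs.prod hu), Measure.map_apply hsh (hs.prod hu),
    Measure.prod_apply hms, lintegral_map (measurable_measure_prodMk_left hms) hage,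
    Measure.restrict_apply (hpair (hs.prod hu))]
  have hset : (fun ω => (X.age ω, X.hold 0 ω)) ⁻¹' s ×ˢ u ∩ B =
      (B ∩ X.age ⁻¹' s) ∩ X.hold 0 ⁻¹' u := by
    ext ω
    simp only [mem_inter_iff, mem_preimage, mem_prod]
    tauto
  rw [hset, h1, inter_comm B, ← Measure.restrict_restrict (hage hs),
    ← lintegral_indicator (hage hs)]
  refine lintegral_congr fun ω => ?_
  by_cases h : X.age ω ∈ s
  · rw [indicator_of_mem (by exact h)]
    congr 1
    ext x
    simp [h]
  · rw [indicator_of_notMem (by exact h)]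
    refine (measure_mono_null (fun x hx => ?_) measure_empty).symm
    exact h hx.1

/-- Given the past, the time from `t₁` or the later beginning of possession `m` until the end of
this possession is exponentially distributed. -/
theorem measure_inter_preimage_residual {m : ℕ} {i : Fin 22} {B : Set Ω}
    (hB : MeasurableSet[X.history 𝓖 m] B) (hBi : B ⊆ X.holder m ⁻¹' {i})
    (hBt : ∀ ω ∈ B, X.baseTime t₁ m ω < t₂) {C : Set ℝ} (hC : MeasurableSet C) :
    P (B ∩ (fun ω => X.startTime t₁ (m + 1) ω - X.baseTime t₁ m ω) ⁻¹' C) =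
      P B * expMeasure (M.rate i) C := by
  have := isProbabilityMeasure_expMeasure (M.rate_pos i)
  rcases m with _ | m
  · have h := hX.map_age_hold_zero hB hBi
    have hage : Measurable X.age := hX.measurable_age.mono hX.past_le le_rfl
    have hset : MeasurableSet {p : ℝ × ℝ | p.2 - p.1 ∈ C} :=
      (measurable_snd.sub measurable_fst) hC
    have h' := congrArg (fun ν => ν {p : ℝ × ℝ | p.2 - p.1 ∈ C}) h
    have hpair : Measurable fun ω => (X.age ω, X.hold 0 ω) := hage.prodMk (hX.measurable_hold 0)
    have hsh : Measurable fun p : ℝ × ℝ => (p.1, p.2 + p.1) := by fun_prop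
    rw [Measure.map_apply hpair hset, Measure.map_apply hsh hset,
      Measure.restrict_apply (hpair hset)] at h'
    -- Subtracting the age undoes the shift and leaves the fresh exponential time.
    have e1 : (fun p : ℝ × ℝ => (p.1, p.2 + p.1)) ⁻¹' {p : ℝ × ℝ | p.2 - p.1 ∈ C} =
        univ ×ˢ C := by
      ext p
      simp
    rw [e1, Measure.prod_prod, Measure.map_apply hage MeasurableSet.univ, preimage_univ,
      Measure.restrict_apply_univ] at h'
    rw [← h', inter_comm]
    congr 2
    ext ω
    simp only [startTime, baseTime, mem_preimage, mem_ofPred_eq, if_true, zero_add,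
      Finset.sum_range_one]
    rw [show t₁ - X.age ω + X.hold 0 ω - t₁ = X.hold 0 ω - X.age ω by ring]
  · have h1 : P (B ∩ X.hold (m + 1) ⁻¹' C) = ∫⁻ ω in B, expMeasure (M.rate i) C ∂P := by
      refine measure_inter_eq_setLIntegral_of_condExp (hX.history_le _)
        (hX.measurable_hold _ hC) hB ?_
      filter_upwards [hX.hold_law (m + 1) (Nat.le_add_left 1 m) C hC] with ω hω hmem
      have hi : X.holder (m + 1) ω = i := hBi hmem
      rw [hω (by simpa [baseTime] using hBt ω hmem), hi]
      exact ofReal_measureReal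
    rw [setLIntegral_const, mul_comm] at h1
    rw [← h1]
    congr 2
    ext ω
    simp [startTime_succ _ _ (m + 1), baseTime]

/-- The base time belongs to the history, so intersecting `B` with an event about it turns the
residual law into independence. -/
theorem map_baseTime_residual {m : ℕ} {i : Fin 22} {B : Set Ω}
    (hB : MeasurableSet[X.history 𝓖 m] B) (hBi : B ⊆ X.holder m ⁻¹' {i})
    (hBt : ∀ ω ∈ B, X.baseTime t₁ m ω < t₂) :
    (P.restrict B).map (fun ω => (X.baseTime t₁ m ω,
        X.startTime t₁ (m + 1) ω - X.baseTime t₁ m ω)) =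
      ((P.restrict B).map (X.baseTime t₁ m)).prod (expMeasure (M.rate i)) := by
  have := isProbabilityMeasure_expMeasure (M.rate_pos i)
  have hS := hX.measurable_baseTime m
  have hR : Measurable fun ω => X.startTime t₁ (m + 1) ω - X.baseTime t₁ m ω :=
    (hX.measurable_startTime (m + 1)).sub hS
  refine (Measure.prod_eq fun s u hs hu => ?_).symm
  rw [Measure.map_apply (hS.prodMk hR) (hs.prod hu), Measure.map_apply hS hs,
    Measure.restrict_apply ((hS.prodMk hR) (hs.prod hu)), Measure.restrict_apply (hS hs),
    inter_comm _ B, inter_comm _ B]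
  rw [← hX.measure_inter_preimage_residual
    (MeasurableSet.inter hB (hX.measurable_baseTime_history m hs))
    (inter_subset_left.trans hBi) (fun ω hω => hBt ω hω.1) hu]
  congr 1
  ext ω
  simp only [mem_inter_iff, mem_preimage, mem_prod]
  tauto

/-- Given the past and the holding time, player `k` receives the pass of player `i` with
probability `M.jump i k`. -/
theorem measure_inter_holder_succ {m : ℕ} {i : Fin 22} {C : Set Ω}
    (hC : MeasurableSet[X.history 𝓖 m ⊔ MeasurableSpace.comap (X.hold m) (borel ℝ)] C)
    (hCi : C ⊆ X.holder m ⁻¹' {i}) (hCt : ∀ ω ∈ C, X.startTime t₁ (m + 1) ω < t₂) (k : Fin 22) :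
    P (C ∩ X.holder (m + 1) ⁻¹' {k}) = ENNReal.ofReal (M.jump i k) * P C := by
  have hle1 : X.history 𝓖 m ⊔ MeasurableSpace.comap (X.hold m) (borel ℝ) ≤ mΩ :=
    (X.history_sup_hold_le 𝓖 m).trans (hX.history_le _)
  have hle2 : X.history 𝓖 m ⊔ MeasurableSpace.comap (X.hold m) (borel ℝ) ⊔
      MeasurableSpace.comap (X.success m) ⊤ ≤ mΩ :=
    sup_le hle1 (hX.measurable_success m).comap_le
  have hs : ∀ s, P (C ∩ X.success m ⁻¹' {s}) = ENNReal.ofReal (M.successProb i s) * P C := by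
    intro s
    rw [← setLIntegral_const]
    refine measure_inter_eq_setLIntegral_of_condExp hle1
      (hX.measurable_success m (measurableSet_singleton s)) hC ?_
    filter_upwards [hX.success_law m s] with ω hω hmem
    have hi : X.holder m ω = i := hCi hmem
    rw [hω (hCt ω hmem), hi]
  have hk : ∀ s, P (C ∩ X.success m ⁻¹' {s} ∩ X.holder (m + 1) ⁻¹' {k}) =
      ENNReal.ofReal (M.successProb i s * M.pass i s k) * P C := by
    intro s
    rw [ENNReal.ofReal_mul (M.successProb_nonneg i s), mul_comm (ENNReal.ofReal _), mul_assoc,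
      ← hs, ← setLIntegral_const]
    have hCs : MeasurableSet[X.history 𝓖 m ⊔ MeasurableSpace.comap (X.hold m) (borel ℝ) ⊔
        MeasurableSpace.comap (X.success m) ⊤] (C ∩ X.success m ⁻¹' {s}) :=
      MeasurableSet.inter ((le_sup_left : _ ≤ _ ⊔ MeasurableSpace.comap (X.success m) ⊤) _ hC)
        ((le_sup_right : MeasurableSpace.comap (X.success m) ⊤ ≤ _) _ ⟨{s}, trivial, rfl⟩)
    refine measure_inter_eq_setLIntegral_of_condExp hle2
      (hX.measurable_holder (m + 1) (measurableSet_singleton k)) hCs ?_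
    filter_upwards [hX.pass_law m k] with ω hω hmem
    have hi : X.holder m ω = i := hCi hmem.1
    have hs' : X.success m ω = s := hmem.2
    rw [hω (hCt ω hmem.1), hi, hs']
  -- Total probability over success and failure, the two terms of `jump`.
  have hU : C ∩ X.holder (m + 1) ⁻¹' {k} =
      (C ∩ X.success m ⁻¹' {true} ∩ X.holder (m + 1) ⁻¹' {k}) ∪
        (C ∩ X.success m ⁻¹' {false} ∩ X.holder (m + 1) ⁻¹' {k}) := by
    ext ω
    cases h : X.success m ω <;> simp [h]
  rw [hU, measure_union, hk, hk, ← add_mul, ← ENNReal.ofReal_add, BallModel.jump,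
    Fintype.sum_bool]
  · exact mul_nonneg (M.successProb_nonneg _ _) (M.pass_nonneg _ _ _)
  · exact mul_nonneg (M.successProb_nonneg _ _) (M.pass_nonneg _ _ _)
  · rw [Set.disjoint_left]
    rintro ω ⟨⟨_, h1⟩, _⟩ ⟨⟨_, h2⟩, _⟩
    simp only [mem_preimage, mem_singleton_iff] at h1 h2
    simp [h1] at h2
  · exact ((hle1 _ hC).inter (hX.measurable_success m (measurableSet_singleton _))).inter
      (hX.measurable_holder (m + 1) (measurableSet_singleton k))

/-- During the interval, possessions have a nonnegative duration. -/
theorem ae_le_baseTime {t : ℝ} (ht : t ∈ Ico t₁ t₂) (m : ℕ) :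
    ∀ᵐ ω ∂P, ω ∈ X.passesBy t₁ t m → t₁ ≤ X.baseTime t₁ m ω := by
  induction m with
  | zero => exact Eventually.of_forall fun ω _ => by simp [baseTime]
  | succ m ih =>
    -- A negative residual time has probability zero under the exponential law.
    have hB : ∀ i, ∀ᵐ ω ∂P, ω ∈ X.passesBy t₁ t m ∩ X.holder m ⁻¹' {i} →
        X.baseTime t₁ m ω ≤ X.startTime t₁ (m + 1) ω := by
      intro i
      have h := hX.measure_inter_preimage_residual (i := i)
        (MeasurableSet.inter (hX.measurableSet_passesBy t m)
          (X.measurable_holder_history 𝓖 m (measurableSet_singleton i)))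
        inter_subset_right (fun ω hω => (X.baseTime_le t₁ ht.1 hω.1).trans_lt ht.2)
        (measurableSet_Iio (a := (0 : ℝ)))
      rw [expMeasure_Iio_zero, mul_zero] at h
      rw [ae_iff]
      refine measure_mono_null (fun ω hω => ?_) h
      simp only [mem_ofPred_eq, Classical.not_imp, not_le] at hω
      exact ⟨hω.1, by simpa using hω.2⟩
    filter_upwards [ih, ae_all_iff.2 hB] with ω h1 h2 h3
    have h3' := X.passesBy_antitone t₁ t m.le_succ h3
    exact (h1 h3').trans (h2 _ ⟨h3', rfl⟩)

/-- There are almost surely finitely many passes by any time in the interval. -/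
theorem tendsto_measure_passesBy {t : ℝ} (ht : t ∈ Ico t₁ t₂) :
    Tendsto (fun m => P.real (X.passesBy t₁ t m)) atTop (𝓝 0) := by
  set c := t - t₁ with hc
  have hc0 : 0 ≤ c := sub_nonneg.2 ht.1
  -- The sum of all rates dominates each single rate, so `ρ` bounds, for every holder, the
  -- probability that a residual time is at most `c`.
  set ρ : ℝ := 1 - Real.exp (-((∑ i, M.rate i) * c)) with hρ
  have hρ0 : 0 ≤ ρ := by
    rw [hρ, sub_nonneg, Real.exp_le_one_iff, neg_nonpos]
    exact mul_nonneg (Finset.sum_nonneg fun i _ => (M.rate_pos i).le) hc0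
  have hρ1 : ρ < 1 := by
    have := Real.exp_pos (-((∑ i, M.rate i) * c))
    linarith
  have hstep : ∀ m, P.real (X.passesBy t₁ t (m + 1)) ≤ ρ * P.real (X.passesBy t₁ t m) := by
    intro m
    have hmeas : ∀ m, MeasurableSet (X.passesBy t₁ t m) := fun m =>
      hX.history_le m _ (hX.measurableSet_passesBy t m)
    have hsum : ∀ s : Set Ω, MeasurableSet s →
        P.real s = ∑ i, P.real (s ∩ X.holder m ⁻¹' {i}) := by
      intro s hs
      have h := setIntegral_eq_sum_inter_preimage (μ := P) hs (hX.measurable_holder m)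
        (f := fun _ => (1 : ℝ)) (integrable_const 1).integrableOn
      simpa using h
    rw [hsum _ (hmeas (m + 1)), hsum _ (hmeas m), Finset.mul_sum]
    refine Finset.sum_le_sum fun i _ => ?_
    have h := hX.measure_inter_preimage_residual (i := i)
      (MeasurableSet.inter (hX.measurableSet_passesBy t m)
        (X.measurable_holder_history 𝓖 m (measurableSet_singleton i)))
      inter_subset_right (fun ω hω => (X.baseTime_le t₁ ht.1 hω.1).trans_lt ht.2)
      (measurableSet_Iic (a := c))
    have h' := congrArg ENNReal.toReal h
    rw [ENNReal.toReal_mul, ← measureReal_def, ← measureReal_def, ← measureReal_def,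
      expMeasure_real_Iic (M.rate_pos i) hc0] at h'
    -- Almost surely the base time is at least `t₁`, so a pass made by `t` forces a residual time of
    -- at most `t - t₁`.
    have hle : P.real (X.passesBy t₁ t (m + 1) ∩ X.holder m ⁻¹' {i}) ≤
        P.real (X.passesBy t₁ t m ∩ X.holder m ⁻¹' {i} ∩
          (fun ω => X.startTime t₁ (m + 1) ω - X.baseTime t₁ m ω) ⁻¹' Iic c) := by
      refine ENNReal.toReal_mono (measure_ne_top _ _) (measure_mono_ae ?_)
      filter_upwards [hX.ae_le_baseTime ht m] with ω h1 h2
      rw [passesBy_succ] at h2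
      refine ⟨⟨h2.1.1, h2.2⟩, ?_⟩
      have h3 := h1 h2.1.1
      have h4 : X.startTime t₁ (m + 1) ω ≤ t := h2.1.2
      simp only [mem_preimage, mem_Iic, hc]
      linarith
    refine hle.trans ?_
    rw [h', mul_comm]
    refine mul_le_mul_of_nonneg_right ?_ measureReal_nonneg
    rw [hρ]
    have : M.rate i ≤ ∑ i, M.rate i :=
      Finset.single_le_sum (fun i _ => (M.rate_pos i).le) (Finset.mem_univ i)
    gcongr
  have hpow : ∀ m, P.real (X.passesBy t₁ t m) ≤ ρ ^ m := by
    intro m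
    induction m with
    | zero => simp
    | succ m ih =>
      rw [pow_succ']
      exact (hstep m).trans (mul_le_mul_of_nonneg_left ih hρ0)
  exact squeeze_zero (fun _ => measureReal_nonneg) hpow
    (tendsto_pow_atTop_nhds_zero_of_lt_one hρ0 hρ1)

end IsBallControl

theorem ProbabilityTheory.measureReal_cond_apply {Ω : Type*} [MeasurableSpace Ω] {P : Measure Ω}
    {s : Set Ω} (hs : MeasurableSet s) (A : Set Ω) :
    (P[|s]).real A = (P.real s)⁻¹ * P.real (s ∩ A) := by
  rw [measureReal_def, cond_apply hs, ENNReal.toReal_mul, ENNReal.toReal_inv, measureReal_def,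
    measureReal_def]

/-! ### Paths of the control process -/

namespace Possessions

variable {Ω : Type*} (X : Possessions Ω) (t₁ : ℝ)

theorem passesBy_mono {s t : ℝ} (hst : s ≤ t) (m : ℕ) :
    X.passesBy t₁ s m ⊆ X.passesBy t₁ t m :=
  fun _ h k hk => (h k hk).trans hst

theorem control_eq_holder {t : ℝ} {m : ℕ} {ω : Ω} (h : ω ∈ X.passesBy t₁ t m)
    (hm : t < X.startTime t₁ (m + 1) ω) : X.control t₁ t ω = X.holder m ω := by
  have hl : IsLeast {k | t < X.startTime t₁ (k + 1) ω} m := by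
    refine ⟨hm, fun k hk => ?_⟩
    by_contra hkm
    exact absurd (h k (not_le.1 hkm)) (not_le.2 hk)
  rw [control, hl.csInf_eq]

theorem exists_mem_passesBy {t : ℝ} {n : ℕ} {ω : Ω} (h : t < X.startTime t₁ (n + 1) ω) :
    ∃ m ≤ n, ω ∈ X.passesBy t₁ t m ∧ t < X.startTime t₁ (m + 1) ω := by
  classical
  have hex : ∃ k, t < X.startTime t₁ (k + 1) ω := ⟨n, h⟩
  exact ⟨Nat.find hex, Nat.find_min' hex h, fun k hk => not_lt.1 (Nat.find_min hex hk),
    Nat.find_spec hex⟩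

theorem exists_mem_passesBy_of_notMem {t : ℝ} {n : ℕ} {ω : Ω} (h : ω ∉ X.passesBy t₁ t n) :
    ∃ m, ω ∈ X.passesBy t₁ t m ∧ t < X.startTime t₁ (m + 1) ω := by
  simp only [passesBy, mem_ofPred_eq, not_forall, not_le] at h
  obtain ⟨k, _, hk⟩ := h
  obtain ⟨m, _, hm⟩ := X.exists_mem_passesBy t₁ hk
  exact ⟨m, hm⟩

/-- Here `sInf ∅ = 0` decides. For `t` in the interval this event is null, but measurability of
`control` has to cover it. -/
theorem control_eq_holder_zero {t : ℝ} {ω : Ω} (h : ∀ n, ω ∈ X.passesBy t₁ t n) :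
    X.control t₁ t ω = X.holder 0 ω := by
  have he : {k | t < X.startTime t₁ (k + 1) ω} = ∅ := by
    ext k
    simpa using h (k + 1) k k.lt_succ_self
  rw [control, he, Nat.sInf_empty]

theorem eventually_control_eq {t : ℝ} {n : ℕ} {ω : Ω} (h : ω ∉ X.passesBy t₁ t n) :
    ∀ᶠ s in 𝓝[≥] t, X.control t₁ s ω = X.control t₁ t ω := by
  obtain ⟨m, hm, hlt⟩ := X.exists_mem_passesBy_of_notMem t₁ h
  filter_upwards [Ico_mem_nhdsGE hlt] with s hs
  rw [X.control_eq_holder t₁ hm hlt, X.control_eq_holder t₁ (X.passesBy_mono t₁ hs.1 m hm) hs.2]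

theorem measurable_control_past (𝓖 : MeasurableSpace Ω) {t : ℝ} (ht : t₁ ≤ t) :
    Measurable[X.past 𝓖 t₁ t, ⊤] (X.control t₁ t) := by
  refine Measurable.of_comap_le (le_trans ?_ le_sup_right)
  exact le_iSup₂_of_le (f := fun s (_ : s ∈ Icc t₁ t) =>
    MeasurableSpace.comap (X.control t₁ s) ⊤) t ⟨ht, le_rfl⟩ le_rfl

end Possessions

/-! ### The Markov property -/

namespace IsBallControl

open Possessions

variable {Ω : Type*} {𝓖 : MeasurableSpace Ω} [mΩ : MeasurableSpace Ω] {P : Measure Ω}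
  {M : BallModel} {t₁ t₂ : ℝ} {X : Possessions Ω} (hX : IsBallControl 𝓖 P M t₁ t₂ X)

include hX

theorem measurable_control (t : ℝ) : Measurable (X.control t₁ t) := by
  have hF : ∀ m, MeasurableSet (X.passesBy t₁ t m) := fun m =>
    hX.history_le m _ (hX.measurableSet_passesBy t m)
  refine measurable_to_countable' fun j => ?_
  have hU : X.control t₁ t ⁻¹' {j} =
      (⋃ m, X.passesBy t₁ t m ∩ X.startTime t₁ (m + 1) ⁻¹' Ioi t ∩ X.holder m ⁻¹' {j}) ∪
        ((⋂ m, X.passesBy t₁ t m) ∩ X.holder 0 ⁻¹' {j}) := by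
    ext ω
    simp only [mem_preimage, mem_singleton_iff, mem_union, mem_iUnion, mem_inter_iff, mem_iInter,
      mem_Ioi]
    constructor
    · intro h
      by_cases hall : ∀ n, ω ∈ X.passesBy t₁ t n
      · exact Or.inr ⟨hall, by rw [← X.control_eq_holder_zero t₁ hall, h]⟩
      · obtain ⟨n, hn⟩ := not_forall.1 hall
        obtain ⟨m, hm, hlt⟩ := X.exists_mem_passesBy_of_notMem t₁ hn
        exact Or.inl ⟨m, ⟨hm, hlt⟩, by rw [← X.control_eq_holder t₁ hm hlt, h]⟩
    · rintro (⟨m, ⟨hm, hlt⟩, h⟩ | ⟨hall, h⟩)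
      · rw [X.control_eq_holder t₁ hm hlt, h]
      · rw [X.control_eq_holder_zero t₁ hall, h]
  rw [hU]
  exact (MeasurableSet.iUnion fun m => ((hF m).inter
    (hX.measurable_startTime (m + 1) measurableSet_Ioi)).inter
      (hX.measurable_holder m (measurableSet_singleton j))).union
    ((MeasurableSet.iInter hF).inter (hX.measurable_holder 0 (measurableSet_singleton j)))

theorem control_past_le (t : ℝ) : X.past 𝓖 t₁ t ≤ mΩ :=
  sup_le hX.past_le (iSup₂_le fun s _ => (hX.measurable_control s).comap_le)

/-- While possession `m` is in progress, what is known about the past of the process is known at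
the beginning of this possession. -/
theorem exists_measurableSet_history_inter_eq {t : ℝ} (m : ℕ) {A : Set Ω}
    (hA : MeasurableSet[X.past 𝓖 t₁ t] A) :
    ∃ B, MeasurableSet[X.history 𝓖 m] B ∧ B ⊆ X.passesBy t₁ t m ∧
      A ∩ (X.passesBy t₁ t m ∩ X.startTime t₁ (m + 1) ⁻¹' Ioi t) =
        B ∩ X.startTime t₁ (m + 1) ⁻¹' Ioi t := by
  set D : Set Ω := X.passesBy t₁ t m ∩ X.startTime t₁ (m + 1) ⁻¹' Ioi t with hD
  -- The sets whose trace on `D` is the trace of an event of the history form a σ-algebra, so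
  -- generators of the past suffice.
  have hle : X.past 𝓖 t₁ t ≤
      ((X.history 𝓖 m).comap (Subtype.val : D → Ω)).map (Subtype.val : D → Ω) := by
    refine sup_le ((X.past_le_history 𝓖 m).trans MeasurableSpace.le_map_comap) ?_
    refine iSup₂_le fun s hs => ?_
    rintro _ ⟨V, -, rfl⟩
    -- The possession in progress at `s ≤ t` has some index `k ≤ m`. For `k = m` its end is not in
    -- the history of `m`, but on `D` it automatically lies after `s`, so the condition is imposed
    -- for `k < m` only.
    refine ⟨⋃ k ∈ Finset.range (m + 1), X.passesBy t₁ s k ∩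
      {ω | k < m → s < X.startTime t₁ (k + 1) ω} ∩ X.holder k ⁻¹' V, ?_, ?_⟩
    · refine Finset.measurableSet_biUnion _ fun k hk => ?_
      have hkm : k ≤ m := Nat.lt_succ_iff.1 (Finset.mem_range.1 hk)
      refine MeasurableSet.inter (MeasurableSet.inter
        (X.history_mono 𝓖 hkm _ (hX.measurableSet_passesBy s k)) ?_)
        (X.history_mono 𝓖 hkm _ (X.measurable_holder_history 𝓖 k V.toFinite.measurableSet))
      by_cases h : k < m
      · simp only [h, forall_true_left]
        exact X.history_mono 𝓖 h _ (hX.measurable_startTime_history (k + 1) measurableSet_Ioi)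
      · simp [h]
    · ext ⟨ω, hω⟩
      have hsm : s < X.startTime t₁ (m + 1) ω := hs.2.trans_lt hω.2
      simp only [mem_preimage, mem_iUnion, Finset.mem_range, Nat.lt_succ_iff, mem_inter_iff,
        mem_ofPred_eq, exists_prop]
      constructor
      · rintro ⟨k, hk, ⟨hF, hlt⟩, hV⟩
        have hlt' : s < X.startTime t₁ (k + 1) ω := by
          rcases hk.lt_or_eq with h | rfl
          exacts [hlt h, hsm]
        rwa [X.control_eq_holder t₁ hF hlt']
      · intro hV
        obtain ⟨k, hk, hF, hlt⟩ := X.exists_mem_passesBy t₁ hsm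
        rw [X.control_eq_holder t₁ hF hlt] at hV
        exact ⟨k, hk, ⟨hF, fun _ => hlt⟩, hV⟩
  obtain ⟨B, hB, hBA⟩ := hle A hA
  refine ⟨B ∩ X.passesBy t₁ t m, MeasurableSet.inter hB (hX.measurableSet_passesBy t m),
    inter_subset_right, ?_⟩
  rw [inter_assoc, ← hD, inter_comm A, inter_comm B, ← Subtype.image_preimage_coe,
    ← Subtype.image_preimage_coe, hBA]

variable [IsProbabilityMeasure P]

theorem ae_exists_notMem_passesBy {t : ℝ} (ht : t ∈ Ico t₁ t₂) :
    ∀ᵐ ω ∂P, ∃ n, ω ∉ X.passesBy t₁ t n := by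
  rw [ae_iff]
  refine (measureReal_eq_zero_iff).1 (le_antisymm ?_ measureReal_nonneg)
  refine ge_of_tendsto' (hX.tendsto_measure_passesBy ht) fun n => ?_
  refine measureReal_mono fun ω hω => ?_
  simp only [mem_ofPred_eq, not_exists, not_not] at hω
  exact hω n

theorem ae_eventually_control_eq :
    ∀ᵐ ω ∂P, ∀ t ∈ Ico t₁ t₂, ∀ᶠ s in 𝓝[≥] t, X.control t₁ s ω = X.control t₁ t ω := by
  -- Finitely many passes by a rational `q ∈ (t, t₂)` imply the same by `t`, so countably many null
  -- sets serve all `t`.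
  have h : ∀ q : ℚ, ∀ᵐ ω ∂P, (q : ℝ) ∈ Ico t₁ t₂ → ∃ n, ω ∉ X.passesBy t₁ q n := by
    intro q
    by_cases hq : (q : ℝ) ∈ Ico t₁ t₂
    · filter_upwards [hX.ae_exists_notMem_passesBy hq] with ω hω _ using hω
    · exact Eventually.of_forall fun ω h => absurd h hq
  filter_upwards [ae_all_iff.2 h] with ω hω t ht
  obtain ⟨q, hq1, hq2⟩ := exists_rat_btwn ht.2
  obtain ⟨n, hn⟩ := hω q ⟨ht.1.trans hq1.le, hq2⟩
  exact X.eventually_control_eq t₁ fun h => hn (X.passesBy_mono t₁ hq1.le n h)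

/-- One first-jump step, summed over the holder. The starting time `S` serves both as the base time
and as a constant `t` inside the possession; in the second case `D` depends on the holding time. -/
theorem setIntegral_transition_eq {T : ℝ} (hT : T ∈ Ico t₁ t₂) {m : ℕ} {D : Set Ω}
    (hD : MeasurableSet[X.history 𝓖 m ⊔ MeasurableSpace.comap (X.hold m) (borel ℝ)] D)
    {S : Ω → ℝ} (hS : Measurable S)
    (hlaw : ∀ i, (P.restrict (D ∩ X.holder m ⁻¹' {i})).map
        (fun ω => (S ω, X.startTime t₁ (m + 1) ω - S ω)) =
      ((P.restrict (D ∩ X.holder m ⁻¹' {i})).map S).prod (expMeasure (M.rate i)))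
    (hS₀ : ∀ᵐ ω ∂P, ω ∈ D → t₁ ≤ S ω) (hST : ∀ ω ∈ D, S ω ≤ T) (j : Fin 22) :
    ∫ ω in D, NormedSpace.exp ((T - S ω) • M.generator) (X.holder m ω) j ∂P =
      P.real (D ∩ X.startTime t₁ (m + 1) ⁻¹' Ioi T ∩ X.holder m ⁻¹' {j}) +
        ∫ ω in D ∩ X.startTime t₁ (m + 1) ⁻¹' Iic T,
          NormedSpace.exp ((T - X.startTime t₁ (m + 1) ω) • M.generator)
            (X.holder (m + 1) ω) j ∂P := by
  have hsup : X.history 𝓖 m ⊔ MeasurableSpace.comap (X.hold m) (borel ℝ) ≤ mΩ :=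
    (X.history_sup_hold_le 𝓖 m).trans (hX.history_le _)
  have hDm : MeasurableSet D := hsup _ hD
  have hN := hX.measurable_startTime (m + 1)
  have hK := hX.measurable_holder
  have hHi : ∀ i, MeasurableSet (X.holder m ⁻¹' {i}) := fun i => hK m (measurableSet_singleton i)
  have hDi : ∀ i, MeasurableSet (D ∩ X.holder m ⁻¹' {i}) := fun i => hDm.inter (hHi i)
  obtain ⟨C, hC0, hC⟩ := M.exists_transition_bound (T - t₁)
  have hmeasG : Measurable fun p : Fin 22 × ℝ => NormedSpace.exp ((T - p.2) • M.generator) p.1 j :=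
    measurable_from_prod_countable_right fun k =>
      ((M.generator.continuous_exp_smul_apply k j).comp
        (continuous_const.sub continuous_id)).measurable
  have hint1 : IntegrableOn (fun ω => NormedSpace.exp ((T - S ω) • M.generator)
      (X.holder m ω) j) D P := by
    refine Integrable.of_bound (hmeasG.comp ((hK m).prodMk hS)).aestronglyMeasurable C ?_
    rw [ae_restrict_iff' hDm]
    filter_upwards [hS₀] with ω h1 h2
    exact hC _ _ _ ⟨sub_nonneg.2 (hST ω h2), sub_le_sub_left (h1 h2) _⟩
  have hNle : ∀ i, ∀ᵐ ω ∂P, ω ∈ D ∩ X.holder m ⁻¹' {i} →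
      S ω ≤ X.startTime t₁ (m + 1) ω := fun i =>
    (ae_restrict_iff' (hDi i)).1
      (ae_le_of_map_eq_prod_expMeasure (M.rate_pos i) hS hN (hlaw i))
  have hDN : MeasurableSet (D ∩ X.startTime t₁ (m + 1) ⁻¹' Iic T) :=
    hDm.inter (hN measurableSet_Iic)
  have hint2 : IntegrableOn (fun ω => NormedSpace.exp
      ((T - X.startTime t₁ (m + 1) ω) • M.generator) (X.holder (m + 1) ω) j)
      (D ∩ X.startTime t₁ (m + 1) ⁻¹' Iic T) P := by
    refine Integrable.of_bound (hmeasG.comp ((hK (m + 1)).prodMk hN)).aestronglyMeasurable C ?_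
    rw [ae_restrict_iff' hDN]
    filter_upwards [hS₀, ae_all_iff.2 hNle] with ω h1 h2 h3
    exact hC _ _ _ ⟨sub_nonneg.2 h3.2, sub_le_sub_left ((h1 h3.1).trans (h2 _ ⟨h3.1, rfl⟩)) _⟩
  have hi : ∀ i, ∫ ω in D ∩ X.holder m ⁻¹' {i},
      NormedSpace.exp ((T - S ω) • M.generator) (X.holder m ω) j ∂P =
        (if i = j then 1 else 0) *
            P.real (D ∩ X.startTime t₁ (m + 1) ⁻¹' Ioi T ∩ X.holder m ⁻¹' {i}) +
          ∫ ω in D ∩ X.startTime t₁ (m + 1) ⁻¹' Iic T ∩ X.holder m ⁻¹' {i},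
            NormedSpace.exp ((T - X.startTime t₁ (m + 1) ω) • M.generator)
              (X.holder (m + 1) ω) j ∂P := by
    intro i
    have h := M.integral_transition_eq (μ := P.restrict (D ∩ X.holder m ⁻¹' {i})) i j hS hN
      (hK (m + 1)) (hlaw i) (s₀ := t₁) (T := T)
      ((ae_restrict_iff' (hDi i)).2 (hS₀.mono fun ω h h' => h h'.1))
      ((ae_restrict_iff' (hDi i)).2 (Eventually.of_forall fun ω h => hST ω h.1)) ?_
    · rw [Measure.restrict_restrict (hN measurableSet_Iic),
        measureReal_restrict_apply (hN measurableSet_Ioi)] at h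
      have e1 : ∀ s : Set Ω, s ∩ (D ∩ X.holder m ⁻¹' {i}) = D ∩ s ∩ X.holder m ⁻¹' {i} := by
        intro s
        rw [← inter_assoc, inter_comm s]
      rw [e1, e1] at h
      rw [← h]
      refine setIntegral_congr_fun (hDi i) fun ω hω => ?_
      have : X.holder m ω = i := hω.2
      simp only [this]
    -- `U ⊆ Iic T` and `T < t₂` place the pass inside the interval, where its law is assumed.
    · intro k U hU hUT
      have hset : MeasurableSet[X.history 𝓖 m ⊔ MeasurableSpace.comap (X.hold m) (borel ℝ)]
          (X.startTime t₁ (m + 1) ⁻¹' U ∩ (D ∩ X.holder m ⁻¹' {i})) :=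
        MeasurableSet.inter (hX.measurable_startTime_succ_sup m hU) (MeasurableSet.inter hD
          ((le_sup_left : X.history 𝓖 m ≤ _) _
            (X.measurable_holder_history 𝓖 m (measurableSet_singleton i))))
      have h := hX.measure_inter_holder_succ hset
        (inter_subset_right.trans inter_subset_right)
        (fun ω hω => lt_of_le_of_lt (hUT hω.1) hT.2) k
      rw [measureReal_def, measureReal_def, Measure.restrict_apply (hN hU),
        Measure.restrict_apply ((hN hU).inter (hK (m + 1) (measurableSet_singleton k))),
        inter_right_comm, h, ENNReal.toReal_mul, ENNReal.toReal_ofReal (M.jump_nonneg i k)]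
  rw [setIntegral_eq_sum_inter_preimage hDm (hK m) hint1,
    setIntegral_eq_sum_inter_preimage hDN (hK m) hint2, Finset.sum_congr rfl fun i _ => hi i,
    Finset.sum_add_distrib]
  simp

/-- The conditional probability that player `j` is in control at time `T`, given the possessions
before a possession that begins by time `T`. -/
theorem setIntegral_transition_baseTime_eq {T : ℝ} (hT : T ∈ Ico t₁ t₂) (j : Fin 22) {n : ℕ}
    {E : Set Ω} (hE : MeasurableSet[X.history 𝓖 n] E) (hET : E ⊆ X.passesBy t₁ T n) :
    ∫ ω in E, NormedSpace.exp ((T - X.baseTime t₁ n ω) • M.generator) (X.holder n ω) j ∂P =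
      P.real (E ∩ X.control t₁ T ⁻¹' {j}) := by
  obtain ⟨C, hC0, hC⟩ := M.exists_transition_bound (T - t₁)
  -- The contribution of possession `n` still in progress at `T` is the same on both sides and
  -- cancels.
  have hstep : ∀ n (E : Set Ω), MeasurableSet[X.history 𝓖 n] E → E ⊆ X.passesBy t₁ T n →
      ∃ E', MeasurableSet[X.history 𝓖 (n + 1)] E' ∧ E' ⊆ X.passesBy t₁ T (n + 1) ∧
      ∫ ω in E, NormedSpace.exp ((T - X.baseTime t₁ n ω) • M.generator) (X.holder n ω) j ∂P -
        P.real (E ∩ X.control t₁ T ⁻¹' {j}) =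
      ∫ ω in E', NormedSpace.exp ((T - X.baseTime t₁ (n + 1) ω) • M.generator)
        (X.holder (n + 1) ω) j ∂P - P.real (E' ∩ X.control t₁ T ⁻¹' {j}) := by
    intro n E hE hET
    have hN := hX.measurable_startTime (n + 1)
    refine ⟨E ∩ X.startTime t₁ (n + 1) ⁻¹' Iic T, MeasurableSet.inter
      (X.history_mono 𝓖 n.le_succ _ hE) (hX.measurable_startTime_history (n + 1)
        measurableSet_Iic), ?_, ?_⟩
    · rw [passesBy_succ]
      exact inter_subset_inter hET subset_rfl
    have hlaw : ∀ i, _ := fun i => hX.map_baseTime_residual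
      (B := E ∩ X.holder n ⁻¹' {i}) (i := i)
      (MeasurableSet.inter hE (X.measurable_holder_history 𝓖 n (measurableSet_singleton i)))
      inter_subset_right (fun ω hω => (X.baseTime_le t₁ hT.1 (hET hω.1)).trans_lt hT.2)
    rw [hX.setIntegral_transition_eq hT ((le_sup_left : X.history 𝓖 n ≤ _) _ hE)
      (hX.measurable_baseTime n) hlaw
      ((hX.ae_le_baseTime hT n).mono fun ω h h' => h (hET h'))
      (fun ω hω => X.baseTime_le t₁ hT.1 (hET hω)) j]
    have hsplit : P.real (E ∩ X.control t₁ T ⁻¹' {j}) =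
        P.real (E ∩ X.startTime t₁ (n + 1) ⁻¹' Ioi T ∩ X.holder n ⁻¹' {j}) +
          P.real (E ∩ X.startTime t₁ (n + 1) ⁻¹' Iic T ∩ X.control t₁ T ⁻¹' {j}) := by
      rw [← measureReal_inter_add_sdiff (s := E ∩ X.control t₁ T ⁻¹' {j})
        (hN (measurableSet_Ioi (a := T)))]
      congr 2
      · ext ω
        simp only [mem_inter_iff, mem_preimage, mem_Ioi, mem_singleton_iff]
        constructor
        · rintro ⟨⟨h1, h2⟩, h3⟩
          exact ⟨⟨h1, h3⟩, by rw [← X.control_eq_holder t₁ (hET h1) h3, h2]⟩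
        · rintro ⟨⟨h1, h3⟩, h2⟩
          exact ⟨⟨h1, by rw [X.control_eq_holder t₁ (hET h1) h3, h2]⟩, h3⟩
      · ext ω
        simp only [mem_inter_iff, mem_preimage, mem_Ioi, mem_singleton_iff, Set.mem_sdiff, mem_Iic,
          not_lt]
        tauto
    rw [hsplit]
    simp only [baseTime, Nat.succ_ne_zero, if_false]
    ring
  have hiter : ∀ N, ∃ E', MeasurableSet[X.history 𝓖 (n + N)] E' ∧
      E' ⊆ X.passesBy t₁ T (n + N) ∧
      ∫ ω in E, NormedSpace.exp ((T - X.baseTime t₁ n ω) • M.generator) (X.holder n ω) j ∂P -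
        P.real (E ∩ X.control t₁ T ⁻¹' {j}) =
      ∫ ω in E', NormedSpace.exp ((T - X.baseTime t₁ (n + N) ω) • M.generator)
        (X.holder (n + N) ω) j ∂P - P.real (E' ∩ X.control t₁ T ⁻¹' {j}) := by
    intro N
    induction N with
    | zero => exact ⟨E, hE, hET, rfl⟩
    | succ N ih =>
      obtain ⟨E', h1, h2, h3⟩ := ih
      obtain ⟨E'', h1', h2', h3'⟩ := hstep _ _ h1 h2
      exact ⟨E'', h1', h2', h3.trans h3'⟩
  have hbound : ∀ N, |∫ ω in E, NormedSpace.exp ((T - X.baseTime t₁ n ω) • M.generator)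
      (X.holder n ω) j ∂P - P.real (E ∩ X.control t₁ T ⁻¹' {j})| ≤
        (C + 1) * P.real (X.passesBy t₁ T (n + N)) := by
    intro N
    obtain ⟨E', h1, h2, h3⟩ := hiter N
    have hE'm : MeasurableSet E' := hX.history_le _ _ h1
    rw [h3, add_mul, one_mul]
    refine (abs_sub _ _).trans (add_le_add ?_ ?_)
    · refine le_trans ?_ (mul_le_mul_of_nonneg_left (measureReal_mono (μ := P) h2) hC0)
      rw [← Real.norm_eq_abs]
      refine norm_setIntegral_le_of_norm_le_const_ae' (measure_lt_top P E') ?_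
      filter_upwards [hX.ae_le_baseTime hT (n + N)] with ω h4 h5
      exact hC _ _ _ ⟨sub_nonneg.2 (X.baseTime_le t₁ hT.1 (h2 h5)),
        sub_le_sub_left (h4 (h2 h5)) _⟩
    · rw [abs_of_nonneg measureReal_nonneg]
      exact measureReal_mono (inter_subset_left.trans h2)
  have hlim : Tendsto (fun N => (C + 1) * P.real (X.passesBy t₁ T (n + N))) atTop (𝓝 0) := by
    have h := ((hX.tendsto_measure_passesBy hT).comp (tendsto_add_atTop_nat n)).const_mul (C + 1)
    rw [mul_zero] at h
    refine h.congr fun N => ?_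
    simp only [Function.comp_apply, add_comm]
  exact sub_eq_zero.1 (abs_nonpos_iff.1 (ge_of_tendsto' hlim hbound))

/-- Given the past at time `t`, the remaining holding time of the possession in progress is
exponentially distributed. -/
theorem map_remaining {t : ℝ} (ht : t ∈ Ico t₁ t₂) {m : ℕ} {i : Fin 22} {B : Set Ω}
    (hB : MeasurableSet[X.history 𝓖 m] B) (hBi : B ⊆ X.holder m ⁻¹' {i})
    (hBt : B ⊆ X.passesBy t₁ t m) :
    (P.restrict (B ∩ X.startTime t₁ (m + 1) ⁻¹' Ioi t)).map
        (fun ω => (t, X.startTime t₁ (m + 1) ω - t)) =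
      ((P.restrict (B ∩ X.startTime t₁ (m + 1) ⁻¹' Ioi t)).map fun _ => t).prod
        (expMeasure (M.rate i)) := by
  have := isProbabilityMeasure_expMeasure (M.rate_pos i)
  have hBm : MeasurableSet B := hX.history_le m _ hB
  have hN := hX.measurable_startTime (m + 1)
  have hS := hX.measurable_baseTime m
  have hpair : Measurable fun ω => (X.baseTime t₁ m ω,
      X.startTime t₁ (m + 1) ω - X.baseTime t₁ m ω) := hS.prodMk (hN.sub hS)
  have hlaw := hX.map_baseTime_residual hB hBi
    (fun ω hω => (X.baseTime_le t₁ ht.1 (hBt hω)).trans_lt ht.2)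
  have hSt : ∀ᵐ s ∂(P.restrict B).map (X.baseTime t₁ m), s ≤ t :=
    (ae_map_iff hS.aemeasurable measurableSet_Iic).2 ((ae_restrict_iff' hBm).2
      (Eventually.of_forall fun ω hω => X.baseTime_le t₁ ht.1 (hBt hω)))
  -- Memorylessness with elapsed time `t - s`, integrated over the law of the base time; `u = univ`
  -- then identifies the first factor as the mass of the event.
  have key : ∀ u : Set ℝ, MeasurableSet u →
      P ((B ∩ X.startTime t₁ (m + 1) ⁻¹' Ioi t) ∩ {ω | X.startTime t₁ (m + 1) ω - t ∈ u}) =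
        (∫⁻ s, ENNReal.ofReal (Real.exp (-(M.rate i * (t - s))))
          ∂(P.restrict B).map (X.baseTime t₁ m)) * expMeasure (M.rate i) u := by
    intro u hu
    have hset : MeasurableSet {p : ℝ × ℝ | t - p.1 < p.2 ∧ p.2 - (t - p.1) ∈ u} :=
      (measurableSet_lt (measurable_fst.const_sub t) measurable_snd).inter
        ((by fun_prop : Measurable fun p : ℝ × ℝ => p.2 - (t - p.1)) hu)
    have h := congrArg (fun ν => ν {p : ℝ × ℝ | t - p.1 < p.2 ∧ p.2 - (t - p.1) ∈ u}) hlaw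
    beta_reduce at h
    rw [Measure.map_apply hpair hset, Measure.restrict_apply (hpair hset),
      Measure.prod_apply hset] at h
    rw [← lintegral_mul_const _ (by fun_prop)]
    convert h using 1
    · congr 1
      ext ω
      simp only [mem_inter_iff, mem_preimage, mem_Ioi, mem_ofPred_eq]
      rw [show X.startTime t₁ (m + 1) ω - X.baseTime t₁ m ω - (t - X.baseTime t₁ m ω) =
        X.startTime t₁ (m + 1) ω - t by ring, sub_lt_sub_iff_right]
      tauto
    · refine lintegral_congr_ae ?_
      filter_upwards [hSt] with s hs
      exact (expMeasure_memoryless (M.rate i) (sub_nonneg.2 hs) hu).symm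
  have hmass : P (B ∩ X.startTime t₁ (m + 1) ⁻¹' Ioi t) =
      ∫⁻ s, ENNReal.ofReal (Real.exp (-(M.rate i * (t - s))))
        ∂(P.restrict B).map (X.baseTime t₁ m) := by
    have h := key univ MeasurableSet.univ
    simpa using h
  refine (Measure.prod_eq fun s u hs hu => ?_).symm
  have hpt : Measurable fun ω => (t, X.startTime t₁ (m + 1) ω - t) :=
    measurable_const.prodMk (hN.sub_const t)
  rw [Measure.map_apply hpt (hs.prod hu), Measure.map_apply measurable_const hs,
    Measure.restrict_apply (hpt (hs.prod hu))]
  by_cases hts : t ∈ s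
  · have e1 : (fun _ : Ω => t) ⁻¹' s = univ := by
      ext
      simp [hts]
    rw [e1, Measure.restrict_apply_univ, hmass, ← key u hu]
    congr 1
    ext ω
    simp only [mem_inter_iff, mem_preimage, mem_prod, hts, true_and, mem_ofPred_eq]
    tauto
  · have e1 : (fun _ : Ω => t) ⁻¹' s = ∅ := by
      ext
      simp [hts]
    have e2 : (fun ω => (t, X.startTime t₁ (m + 1) ω - t)) ⁻¹' s ×ˢ u = ∅ := by
      ext
      simp [hts]
    rw [e1, e2]
    simp

/-- By memorylessness the possession behaves as if it began at `t`: one first-jump step up to `t +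
h`, then `setIntegral_transition_baseTime_eq` from the next possession on. -/
theorem setIntegral_transition_inProgress_eq {t h : ℝ} (ht : t ∈ Ico t₁ t₂) (hh : 0 ≤ h)
    (hth : t + h < t₂) (j : Fin 22) {m : ℕ} {B : Set Ω} (hB : MeasurableSet[X.history 𝓖 m] B)
    (hBt : B ⊆ X.passesBy t₁ t m) :
    ∫ ω in B ∩ X.startTime t₁ (m + 1) ⁻¹' Ioi t,
        NormedSpace.exp (h • M.generator) (X.holder m ω) j ∂P =
      P.real (B ∩ X.startTime t₁ (m + 1) ⁻¹' Ioi t ∩ X.control t₁ (t + h) ⁻¹' {j}) := by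
  have hT : t + h ∈ Ico t₁ t₂ := ⟨ht.1.trans (le_add_of_nonneg_right hh), hth⟩
  set D := B ∩ X.startTime t₁ (m + 1) ⁻¹' Ioi t
  have hD : MeasurableSet[X.history 𝓖 m ⊔ MeasurableSpace.comap (X.hold m) (borel ℝ)] D :=
    MeasurableSet.inter ((le_sup_left : X.history 𝓖 m ≤ _) _ hB)
      (hX.measurable_startTime_succ_sup m measurableSet_Ioi)
  have hlaw : ∀ i, (P.restrict (D ∩ X.holder m ⁻¹' {i})).map
        (fun ω => (t, X.startTime t₁ (m + 1) ω - t)) =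
      ((P.restrict (D ∩ X.holder m ⁻¹' {i})).map fun _ => t).prod (expMeasure (M.rate i)) := by
    intro i
    have h := hX.map_remaining ht (B := B ∩ X.holder m ⁻¹' {i}) (i := i)
      (MeasurableSet.inter hB (X.measurable_holder_history 𝓖 m (measurableSet_singleton i)))
      inter_subset_right (inter_subset_left.trans hBt)
    rwa [inter_right_comm] at h
  have h1 := hX.setIntegral_transition_eq hT hD (measurable_const (a := t)) hlaw
    (Eventually.of_forall fun _ _ => ht.1) (fun _ _ => le_add_of_nonneg_right hh) j
  have hET : D ∩ X.startTime t₁ (m + 1) ⁻¹' Iic (t + h) ⊆ X.passesBy t₁ (t + h) (m + 1) := by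
    rw [passesBy_succ]
    exact inter_subset_inter ((inter_subset_left.trans hBt).trans
      (X.passesBy_mono t₁ (le_add_of_nonneg_right hh) m)) subset_rfl
  have hE : MeasurableSet[X.history 𝓖 (m + 1)] (D ∩ X.startTime t₁ (m + 1) ⁻¹' Iic (t + h)) :=
    MeasurableSet.inter (X.history_sup_hold_le 𝓖 m _ hD)
      (hX.measurable_startTime_history (m + 1) measurableSet_Iic)
  have h2 := hX.setIntegral_transition_baseTime_eq hT j hE hET
  simp only [baseTime, Nat.succ_ne_zero, if_false] at h2
  rw [add_sub_cancel_left] at h1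
  rw [h1, h2, ← measureReal_inter_add_sdiff (s := D ∩ X.control t₁ (t + h) ⁻¹' {j})
    (hX.measurable_startTime (m + 1) (measurableSet_Ioi (a := t + h)))]
  congr 2
  · ext ω
    simp only [mem_inter_iff, mem_preimage, mem_Ioi, mem_singleton_iff]
    have hc : ω ∈ D → t + h < X.startTime t₁ (m + 1) ω →
        X.control t₁ (t + h) ω = X.holder m ω := fun h1 h3 => X.control_eq_holder t₁
      (X.passesBy_mono t₁ (le_add_of_nonneg_right hh) m (hBt h1.1)) h3
    constructor
    · rintro ⟨⟨h1, h3⟩, h2⟩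
      exact ⟨⟨h1, by rw [hc h1 h3, h2]⟩, h3⟩
    · rintro ⟨⟨h1, h2⟩, h3⟩
      exact ⟨⟨h1, h3⟩, by rw [← hc h1 h3, h2]⟩
  · ext ω
    simp only [mem_inter_iff, mem_preimage, mem_Ioi, mem_singleton_iff, Set.mem_sdiff, mem_Iic,
      not_lt]
    tauto

/-- Almost surely exactly one possession is in progress at `t`, so the identity follows by summing
over its index. -/
theorem setIntegral_transition_control_eq {t h : ℝ} (ht : t ∈ Ico t₁ t₂) (hh : 0 ≤ h)
    (hth : t + h < t₂) (j : Fin 22) {A : Set Ω} (hA : MeasurableSet[X.past 𝓖 t₁ t] A) :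
    ∫ ω in A, NormedSpace.exp (h • M.generator) (X.control t₁ t ω) j ∂P =
      P.real (A ∩ X.control t₁ (t + h) ⁻¹' {j}) := by
  set D : ℕ → Set Ω := fun m => X.passesBy t₁ t m ∩ X.startTime t₁ (m + 1) ⁻¹' Ioi t with hD
  have hAm : MeasurableSet A := hX.control_past_le t _ hA
  have hDm : ∀ m, MeasurableSet (D m) := fun m =>
    (hX.history_le m _ (hX.measurableSet_passesBy t m)).inter
      (hX.measurable_startTime (m + 1) measurableSet_Ioi)
  have hY := hX.measurable_control (t + h) (measurableSet_singleton j)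
  have hi1 : Integrable (fun ω => NormedSpace.exp (h • M.generator) (X.control t₁ t ω) j) P :=
    Integrable.of_bound ((measurable_of_finite fun i =>
      NormedSpace.exp (h • M.generator) i j).comp
        (hX.measurable_control t)).aestronglyMeasurable
      (∑ i, |NormedSpace.exp (h • M.generator) i j|)
      (Eventually.of_forall fun ω => Finset.single_le_sum
        (f := fun i => |NormedSpace.exp (h • M.generator) i j|) (fun _ _ => abs_nonneg _)
        (Finset.mem_univ _))
  have hi2 : Integrable ((X.control t₁ (t + h) ⁻¹' {j}).indicator fun _ => (1 : ℝ)) P :=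
    (integrable_const 1).indicator hY
  have hU : A =ᵐ[P] ⋃ m, A ∩ D m := by
    filter_upwards [hX.ae_exists_notMem_passesBy ht] with ω ⟨n, hn⟩
    obtain ⟨m, hm, hlt⟩ := X.exists_mem_passesBy_of_notMem t₁ hn
    rw [← inter_iUnion]
    refine propext ⟨fun h => ⟨h, mem_iUnion.2 ⟨m, hm, hlt⟩⟩, fun h => h.1⟩
  have hdisj : Pairwise (Function.onFun Disjoint fun m => A ∩ D m) := by
    have hlt : ∀ m n, m < n → Disjoint (A ∩ D m) (A ∩ D n) := by
      intro m n hmn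
      rw [Set.disjoint_left]
      rintro ω ⟨_, h1⟩ ⟨_, h2⟩
      exact absurd (h2.1 m hmn) (not_le.2 h1.2)
    intro m n hmn
    rcases hmn.lt_or_gt with h | h
    exacts [hlt m n h, (hlt n m h).symm]
  have hzero : ∀ m, ∫ ω in A ∩ D m, (NormedSpace.exp (h • M.generator) (X.control t₁ t ω) j -
      (X.control t₁ (t + h) ⁻¹' {j}).indicator (fun _ => (1 : ℝ)) ω) ∂P = 0 := by
    intro m
    obtain ⟨B, hB, hBt, hAB⟩ := hX.exists_measurableSet_history_inter_eq m hA
    have h1 := hX.setIntegral_transition_inProgress_eq ht hh hth j hB hBt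
    rw [← hAB] at h1
    rw [integral_sub hi1.integrableOn hi2.integrableOn, integral_indicator hY,
      Measure.restrict_restrict hY, setIntegral_const, smul_eq_mul, mul_one, inter_comm (_ ⁻¹' _),
      ← h1, sub_eq_zero]
    refine setIntegral_congr_fun (hAm.inter (hDm m)) fun ω hω => ?_
    simp only [X.control_eq_holder t₁ hω.2.1 hω.2.2]
  have htotal : ∫ ω in A, (NormedSpace.exp (h • M.generator) (X.control t₁ t ω) j -
      (X.control t₁ (t + h) ⁻¹' {j}).indicator (fun _ => (1 : ℝ)) ω) ∂P = 0 := by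
    rw [setIntegral_congr_set hU]
    exact (integral_iUnion (fun m => hAm.inter (hDm m)) hdisj
      (hi1.sub hi2).integrableOn).trans ((tsum_congr hzero).trans tsum_zero)
  rw [integral_sub hi1.integrableOn hi2.integrableOn, integral_indicator hY,
    Measure.restrict_restrict hY, setIntegral_const, smul_eq_mul, mul_one, sub_eq_zero] at htotal
  rw [htotal, inter_comm]

theorem isMarkovWithGenerator :
    IsMarkovWithGenerator P (X.past 𝓖 t₁) t₁ t₂ (X.control t₁) M.generator where
  offDiag_nonneg _ _ h := M.generator_nonneg h
  row_sum := M.sum_generator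
  past_le t _ := hX.control_past_le t
  past_mono _ _ _ _ hst := sup_le_sup le_rfl (biSup_mono fun _ hu => ⟨hu.1, hu.2.trans hst⟩)
  adapted _ ht := X.measurable_control_past t₁ 𝓖 ht.1
  right_continuous := hX.ae_eventually_control_eq
  markov t ht h hh hth j := by
    have hY := hX.measurable_control (t + h) (measurableSet_singleton j)
    have hmeas : Measurable[X.past 𝓖 t₁ t] fun ω =>
        NormedSpace.exp (h • M.generator) (X.control t₁ t ω) j := by
      have hf : Measurable[⊤] fun i => NormedSpace.exp (h • M.generator) i j :=
        measurable_from_top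
      exact hf.comp (X.measurable_control_past t₁ 𝓖 ht.1)
    have hint : Integrable (fun ω => NormedSpace.exp (h • M.generator) (X.control t₁ t ω) j) P :=
      Integrable.of_bound (hmeas.mono (hX.control_past_le t) le_rfl).aestronglyMeasurable
        (∑ i, |NormedSpace.exp (h • M.generator) i j|)
        (Eventually.of_forall fun ω => Finset.single_le_sum
          (f := fun i => |NormedSpace.exp (h • M.generator) i j|) (fun _ _ => abs_nonneg _)
          (Finset.mem_univ _))
    refine (ae_eq_condExp_of_forall_setIntegral_eq (hX.control_past_le t)
      ((integrable_const (1 : ℝ)).indicator hY) (fun _ _ _ => hint.integrableOn)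
      (fun A hA _ => ?_) hmeas.stronglyMeasurable.aestronglyMeasurable).symm
    rw [hX.setIntegral_transition_control_eq ht hh hth j hA, integral_indicator hY,
      Measure.restrict_restrict hY, setIntegral_const, smul_eq_mul, mul_one, inter_comm]

/-- On `Y(t) = i` the transition probability is a constant and leaves the integral; conditional
independence and the expansion in `h` both follow. -/
theorem measureReal_inter_control {t h : ℝ} (ht : t ∈ Ico t₁ t₂) (hh : 0 ≤ h) (hth : t + h < t₂)
    (i j : Fin 22) {A : Set Ω} (hA : MeasurableSet[X.past 𝓖 t₁ t] A) :
    P.real (X.control t₁ t ⁻¹' {i} ∩ (X.control t₁ (t + h) ⁻¹' {j} ∩ A)) =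
      P.real (X.control t₁ t ⁻¹' {i} ∩ A) * NormedSpace.exp (h • M.generator) i j := by
  have hi : MeasurableSet[X.past 𝓖 t₁ t] (X.control t₁ t ⁻¹' {i}) :=
    X.measurable_control_past t₁ 𝓖 ht.1 trivial
  have h1 := hX.setIntegral_transition_control_eq ht hh hth j (MeasurableSet.inter hi hA)
  rw [inter_comm _ A, ← inter_assoc, ← h1, ← smul_eq_mul, ← setIntegral_const]
  refine setIntegral_congr_fun (hX.control_past_le t _ (MeasurableSet.inter hi hA)) fun ω hω => ?_
  have : X.control t₁ t ω = i := hω.1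
  simp only [this]

theorem cond_real_control {t h : ℝ} (ht : t ∈ Ico t₁ t₂) (hh : 0 ≤ h) (hth : t + h < t₂)
    (i j : Fin 22) (hP : P (X.control t₁ t ⁻¹' {i}) ≠ 0) :
    (P[|X.control t₁ t ⁻¹' {i}]).real (X.control t₁ (t + h) ⁻¹' {j}) =
      NormedSpace.exp (h • M.generator) i j := by
  have h1 := hX.measureReal_inter_control ht hh hth i j MeasurableSet.univ
  rw [inter_univ, inter_univ] at h1
  have h0 : P.real (X.control t₁ t ⁻¹' {i}) ≠ 0 := (measureReal_ne_zero_iff).2 hP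
  rw [measureReal_cond_apply (hX.measurable_control t (measurableSet_singleton i)), h1,
    inv_mul_cancel_left₀ h0]

theorem cond_inter_control {t h : ℝ} (ht : t ∈ Ico t₁ t₂) (hh : 0 ≤ h) (hth : t + h < t₂)
    (i j : Fin 22) {A : Set Ω} (hA : MeasurableSet[X.past 𝓖 t₁ t] A) :
    P[|X.control t₁ t ⁻¹' {i}] (X.control t₁ (t + h) ⁻¹' {j} ∩ A) =
      P[|X.control t₁ t ⁻¹' {i}] (X.control t₁ (t + h) ⁻¹' {j}) *
        P[|X.control t₁ t ⁻¹' {i}] A := by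
  have hi := hX.measurable_control t (measurableSet_singleton i)
  -- Conditioning on a null event gives the zero measure, so both sides vanish.
  rcases eq_or_ne (P (X.control t₁ t ⁻¹' {i})) 0 with hP | hP
  · simp [cond_eq_zero_of_meas_eq_zero hP]
  rw [← ENNReal.toReal_eq_toReal_iff' (measure_ne_top _ _)
    (ENNReal.mul_ne_top (measure_ne_top _ _) (measure_ne_top _ _)), ENNReal.toReal_mul]
  simp only [← measureReal_def]
  rw [hX.cond_real_control ht hh hth i j hP, measureReal_cond_apply hi, measureReal_cond_apply hi,
    hX.measureReal_inter_control ht hh hth i j hA]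
  ring

end IsBallControl

theorem mainTheorem1 {Ω : Type*} (𝓖 : MeasurableSpace Ω) [mΩ : MeasurableSpace Ω]
    (P : Measure Ω) [IsProbabilityMeasure P] (M : BallModel) (t₁ t₂ : ℝ) (ht : t₁ < t₂)
    (X : Possessions Ω) (hX : IsBallControl 𝓖 P M t₁ t₂ X) :
    IsMarkovWithGenerator P (X.past 𝓖 t₁) t₁ t₂ (X.control t₁) M.generator ∧
    (∀ t ∈ Ico t₁ t₂, ∀ h ∈ Ioo 0 (t₂ - t), ∀ i j,
      ∀ A : Set Ω, MeasurableSet[X.past 𝓖 t₁ t] A →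
        P[|X.control t₁ t ⁻¹' {i}] (X.control t₁ (t + h) ⁻¹' {j} ∩ A) =
          P[|X.control t₁ t ⁻¹' {i}] (X.control t₁ (t + h) ⁻¹' {j}) *
            P[|X.control t₁ t ⁻¹' {i}] A) ∧
    ∃ r : Fin 22 → Fin 22 → ℝ → ℝ,
      (∀ i j, r i j =o[𝓝[>] 0] fun h => h) ∧
      ∀ t ∈ Ico t₁ t₂, ∀ h ∈ Ioo 0 (t₂ - t), ∀ i j, P (X.control t₁ t ⁻¹' {i}) ≠ 0 →
        (P[|X.control t₁ t ⁻¹' {i}]).real (X.control t₁ (t + h) ⁻¹' {j}) =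
          (if i = j then 1 else 0) + M.generator i j * h + r i j h := by
  refine ⟨hX.isMarkovWithGenerator, fun t ht h hh i j A hA =>
    hX.cond_inter_control ht hh.1.le (lt_sub_iff_add_lt'.1 hh.2) i j hA,
    fun i j h => NormedSpace.exp (h • M.generator) i j - (if i = j then 1 else 0) -
      M.generator i j * h, fun i j => M.generator.exp_smul_apply_sub_isLittleO i j,
    fun t ht h hh i j hP => ?_⟩
  rw [hX.cond_real_control ht hh.1.le (lt_sub_iff_add_lt'.1 hh.2) i j hP]
  ring
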